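/- Let $k\ge 2$. A simplicial $k$-multicomplex is a finite multiset $\mathcal S$ of $(k+1)$-element sets; $V(\mathcal S)$ is the union of its members, and its graph $G(\mathcal S)$ is the simple graph on $V(\mathcal S)$ in which two distinct vertices are adjacent if and only if some member of $\mathcal S$ contains both. $\mathcal S$ is a simplicial $k$-cycle if every $k$-element subset of $V(\mathcal S)$ is contained in an even number of members of $\mathcal S$ (counted with multiplicity), and a simplicial $k$-circuit if it is a non-empty simplicial $k$-cycle and no non-empty proper sub-multiset of $\mathcal S$ is a simplicial $k$-cycle. A realisation of a graph $G=(V,E)$ in $\mathbb R^d$ is a map $p:V\to\mathbb R^d$. It is infinitesimally rigid if every $\dot p:V\to\mathbb R^d$ with $(p(i)-p(j))\cdot(\dot p(i)-\dot p(j))=0$ for all $ij\in E$ has the form $\dot p(i)=Ap(i)+t$ $(i\in V)$ for some skew-symmetric matrix $A$ and some $t\in\mathbb R^d$. $G$ is rigid in $\mathbb R^d$ if it has an infinitesimally rigid realisation in $\mathbb R^d$. A non-adjacent vertex pairing of $G$ is a map $*:X\to X$, $x\mapsto x^*$, with $X\subseteq V$, such that $x^{**}=x$, $x^*\ne x$ and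 $xx^*\notin E$ for all $x\in X$. Let $\Gamma$ be a point group of order two, i.e. a subgroup of order two of $O(d)$, with non-identity element $\gamma$. Then $(G,*)$ is $\Gamma$-rigid in $\mathbb R^d$ if $G$ has an infinitesimally rigid realisation $p$ in $\mathbb R^d$ with $p(x^*)=\gamma(p(x))$ for all $x\in X$. **Theorem.** Let $G=(V,E)$ be the graph of a simplicial $k$-circuit with $k\ge 2$, let $X\subseteq V$ with $|X|\le 2k$, let $*:X\to X$ be a non-adjacent vertex pairing of $G$, and let $\Gamma$ be a point group of $\mathbb R^{k+1}$ of order two. Then $(G,*)$ is $\Gamma$-rigid in $\mathbb R^{k+1}$. In particular (the case $X=\emptyset$, Fogelsanger's theorem), $G$ is rigid in $\mathbb R^{k+1}$. -/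

import Mathlib

namespace CircuitRigidity

open scoped Matrix

/-! ### Frameworks and infinitesimal rigidity -/

section Rigidity

variable {V : Type*}

/-- `q` is an infinitesimal motion of the framework `(G, p)` in `ℝ^d`:
`(p i - p j) ⬝ (q i - q j) = 0` for every edge `ij`. -/
def IsInfinitesimalMotion {d : ℕ} (G : SimpleGraph V) (p q : V → Fin d → ℝ) : Prop :=
  ∀ i j : V, G.Adj i j → (p i - p j) ⬝ᵥ (q i - q j) = 0

/-- `q` is a trivial motion of `p`: `q i = A (p i) + t` with `A` a skew-symmetric matrix. -/
def IsTrivialMotion {d : ℕ} (p q : V → Fin d → ℝ) : Prop :=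
  ∃ (A : Matrix (Fin d) (Fin d) ℝ) (t : Fin d → ℝ), Aᵀ = -A ∧ ∀ i : V, q i = A *ᵥ p i + t

/-- Every infinitesimal motion of `(G, p)` is trivial. -/
def IsInfinitesimallyRigid {d : ℕ} (G : SimpleGraph V) (p : V → Fin d → ℝ) : Prop :=
  ∀ q : V → Fin d → ℝ, IsInfinitesimalMotion G p q → IsTrivialMotion p q

/-- `G` is rigid in `ℝ^d`: it has an infinitesimally rigid realisation. -/
def IsRigid (d : ℕ) (G : SimpleGraph V) : Prop :=
  ∃ p : V → Fin d → ℝ, IsInfinitesimallyRigid G p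

/-- A vertex pairing: a free involution `* : X → X` on a finite set `X` of vertices. -/
structure VertexPairing (V : Type*) where
  /-- the set `X` -/
  X : Finset V
  /-- the map `*` -/
  star : X → X
  star_star : ∀ x, star (star x) = x
  star_ne : ∀ x, star x ≠ x

/-- `x x^*` is not an edge, for all `x ∈ X`. -/
def VertexPairing.IsNonAdjacent (P : VertexPairing V) (G : SimpleGraph V) : Prop :=
  ∀ x : P.X, ¬ G.Adj (x : V) (P.star x : V)

/-- A realisation `p` is `Γ`-symmetric: `p (x^*) = γ (p x)` for all `x ∈ X`, where `γ` is the
non-identity element of `Γ` (a subgroup of order two of `O(d)`). -/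
def IsSymmetricRealisation {d : ℕ} (Γ : Subgroup (Matrix.orthogonalGroup (Fin d) ℝ))
    (P : VertexPairing V) (p : V → Fin d → ℝ) : Prop :=
  ∀ γ ∈ Γ, γ ≠ 1 → ∀ x : P.X,
    p (P.star x : V) = (γ : Matrix (Fin d) (Fin d) ℝ) *ᵥ p (x : V)

/-- `(G, *)` is `Γ`-rigid in `ℝ^d`: it has an infinitesimally rigid `Γ`-symmetric realisation. -/
def IsGammaRigid {d : ℕ} (Γ : Subgroup (Matrix.orthogonalGroup (Fin d) ℝ))
    (G : SimpleGraph V) (P : VertexPairing V) : Prop :=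
  ∃ p : V → Fin d → ℝ, IsSymmetricRealisation Γ P p ∧ IsInfinitesimallyRigid G p

end Rigidity

/-! ### Simplicial multicomplexes and circuits -/

section Simplicial

variable {α : Type*}

/-- A simplicial `k`-multicomplex: a finite multiset of `(k+1)`-sets. -/
def IsMulticomplex (k : ℕ) (S : Multiset (Finset α)) : Prop :=
  ∀ U ∈ S, U.card = k + 1

/-- `V(S)`: the elements that lie in some member of `S`, i.e. its `0`-faces. -/
def vertexSet (S : Multiset (Finset α)) : Set α :=
  {v | ∃ U ∈ S, v ∈ U}

/-- `G(S)`: the simple graph on `V(S)` whose edges are the pairs of distinct vertices that lie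
together in some member of `S`, i.e. its `1`-faces. -/
def graph (S : Multiset (Finset α)) : SimpleGraph (vertexSet S) where
  Adj u v := u ≠ v ∧ ∃ U ∈ S, (u : α) ∈ U ∧ (v : α) ∈ U
  symm := ⟨fun _ _ h => ⟨h.1.symm, h.2.imp fun _ hU => ⟨hU.1, hU.2.2, hU.2.1⟩⟩⟩
  loopless := ⟨fun _ h => h.1 rfl⟩

open Classical in
/-- The boundary of a simplicial `k`-multicomplex: the `k`-subsets of `V(S)` contained in an odd
number of members of `S`, counted with multiplicity. -/
def boundary (k : ℕ) (S : Multiset (Finset α)) : Set (Finset α) :=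
  {F | (F : Set α) ⊆ vertexSet S ∧ F.card = k ∧ Odd (S.countP fun U => F ⊆ U)}

/-- A simplicial `k`-cycle: a simplicial `k`-multicomplex with empty boundary. -/
def IsSimplicialCycle (k : ℕ) (S : Multiset (Finset α)) : Prop :=
  IsMulticomplex k S ∧ boundary k S = ∅

/-- A simplicial `k`-circuit: a non-empty simplicial `k`-cycle with no non-empty proper
sub-multiset that is a simplicial `k`-cycle. -/
def IsSimplicialCircuit (k : ℕ) (S : Multiset (Finset α)) : Prop :=
  S ≠ 0 ∧ IsSimplicialCycle k S ∧ ∀ T : Multiset (Finset α), T < S → T ≠ 0 →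
    ¬ IsSimplicialCycle k T

end Simplicial

end CircuitRigidity

/-! The argument is Fogelsanger's induction on the number of vertices by edge contraction, carried
out inside the linear space of symmetric configurations. Put d = k + 1 and let `σ` be the involution
extending `*` by the identity.

Take an edge uv with v fixed by `σ`. Contracting v to u turns the members of S not containing both u
and v into a cycle with fewer vertices. Members may become equal, so multisets are needed, and {U,
U} is the base case. The minimal pieces R of this cycle contract to circuits, which are rigid by
induction; vertex splitting (`RigidOn.split`) restores v and makes the corresponding part of S
rigid. A part T already known to be rigid has boundary faces only in matched pairs F + u, F + v. If
every simplex F + u + v is in S, filling completes T to a cycle, which is S by minimality. Otherwise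
a missing F + u + v leads to a further piece sharing the d vertices of F + u + v with T, and the two
are glued (`symRigid_of_forall_contraction`).

Genericity is replaced by `IsLineOpen`: two such properties, each attained in a linear subspace of
configurations, are attained there together. Symmetry matters in two places. Points needed in
general position may contain at most one pair {x, σ x} (`exists_affIndepOn`). And contraction must
not make partners adjacent: if that obstructs every edge with a fixed endpoint, |X| ≤ 2k forces the
paired vertices to span a cross-polytope graph, joined completely to all fixed vertices, and
rigidity is built by hand (`symRigid_of_no_contraction`). -/

namespace CircuitRigidity

open scoped Matrix

/-! ### Affine independence and infinitesimal isometries. -/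

section AffineIndependence

variable {α : Type*} {d : ℕ}

/-- Homogeneous coordinates of the point `p i`. -/
def homog (p : α → Fin d → ℝ) (i : α) : (Fin d → ℝ) × ℝ := (p i, 1)

/-- The points `p i`, `i ∈ Q`, are affinely independent. -/
def AffIndepOn (p : α → Fin d → ℝ) (Q : Finset α) : Prop :=
  LinearIndepOn ℝ (homog p) (Q : Set α)

lemma exists_dotProduct_eq (f : ((Fin d → ℝ) × ℝ) →ₗ[ℝ] ℝ) :
    ∃ (n : Fin d → ℝ) (c : ℝ), ∀ x s, f (x, s) = n ⬝ᵥ x + c * s := by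
  obtain ⟨n, hn⟩ := (dotProductEquiv ℝ (Fin d)).surjective (f ∘ₗ LinearMap.inl ℝ _ _)
  refine ⟨n, f (0, 1), fun x s => ?_⟩
  have h1 : f (x, 0) = n ⬝ᵥ x := by
    have := congrArg (fun g => g x) hn
    simpa using this.symm
  have h2 : (x, s) = (x, (0 : ℝ)) + s • ((0 : Fin d → ℝ), (1 : ℝ)) := by simp
  rw [h2, map_add, map_smul, h1, smul_eq_mul, mul_comm]

lemma AffIndepOn.congr {p p' : α → Fin d → ℝ} {Q : Finset α} (h : AffIndepOn p Q)
    (hp : ∀ i ∈ Q, p i = p' i) : AffIndepOn p' Q :=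
  (linearIndepOn_congr (fun i hi => by simp [homog, hp i (by simpa using hi)])).1 h

lemma affIndepOn_insert [DecidableEq α] {p : α → Fin d → ℝ} {Q : Finset α} {w : α} (hw : w ∉ Q) :
    AffIndepOn p (insert w Q) ↔
      AffIndepOn p Q ∧ homog p w ∉ Submodule.span ℝ (homog p '' (Q : Set α)) := by
  unfold AffIndepOn
  rw [Finset.coe_insert, linearIndepOn_insert (by simpa using hw)]

lemma AffIndepOn.finrank_span {p : α → Fin d → ℝ} {Q : Finset α} (h : AffIndepOn p Q) :
    Module.finrank ℝ (Submodule.span ℝ (homog p '' (Q : Set α))) = Q.card := by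
  have := finrank_span_eq_card (R := ℝ) (b := fun i : Q => homog p i) h
  rw [Fintype.card_coe] at this
  rw [← this]
  rw [Set.image_eq_range]
  rfl

/-- A point outside the affine span of at most `d` given points. -/
lemma exists_notMem_span (p : α → Fin d → ℝ) (Q : Finset α) (hQ : Q.card ≤ d) :
    ∃ a : Fin d → ℝ, (a, (1 : ℝ)) ∉ Submodule.span ℝ (homog p '' (Q : Set α)) := by
  classical
  by_contra! H
  have htop : Submodule.span ℝ (homog p '' (Q : Set α)) = ⊤ := by
    rw [eq_top_iff]
    rintro ⟨x, s⟩ -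
    have h : (x, s) = (x, (1 : ℝ)) + (s - 1) • ((0 : Fin d → ℝ), (1 : ℝ)) := by
      ext <;> simp
    rw [h]
    exact add_mem (H x) (Submodule.smul_mem _ _ (H 0))
  have h1 := finrank_span_finset_le_card (R := ℝ) (Q.image (homog p))
  rw [Set.finrank, Finset.coe_image, htop, finrank_top] at h1
  have h2 : (Q.image (homog p)).card ≤ Q.card := Finset.card_image_le
  simp at h1
  omega

/-- A vector with equal inner products with `d + 1` affinely independent points vanishes. -/
lemma AffIndepOn.eq_zero {p : α → Fin d → ℝ} {Q : Finset α} (h : AffIndepOn p Q)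
    (hQ : Q.card = d + 1) {y : Fin d → ℝ} {m : ℝ} (hy : ∀ i ∈ Q, y ⬝ᵥ p i = m) : y = 0 := by
  let f : ((Fin d → ℝ) × ℝ) →ₗ[ℝ] ℝ :=
    (dotProductEquiv ℝ (Fin d) y) ∘ₗ LinearMap.fst ℝ _ _ - m • LinearMap.snd ℝ _ _
  have hf : ∀ x s, f (x, s) = y ⬝ᵥ x - m * s := fun x s => by simp [f]
  have htop : Submodule.span ℝ (homog p '' (Q : Set α)) = ⊤ := by
    apply Submodule.eq_top_of_finrank_eq
    rw [h.finrank_span, hQ]; simp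
  have hle : Submodule.span ℝ (homog p '' (Q : Set α)) ≤ LinearMap.ker f := by
    rw [Submodule.span_le]
    rintro _ ⟨i, hi, rfl⟩
    simp [homog, hf, hy i (by simpa using hi)]
  have h0 : (y, (0 : ℝ)) ∈ LinearMap.ker f := hle (htop ▸ Submodule.mem_top)
  rw [LinearMap.mem_ker, hf] at h0
  simpa using h0

lemma skew_dotProduct {A : Matrix (Fin d) (Fin d) ℝ} (hA : Aᵀ = -A) (x y : Fin d → ℝ) :
    x ⬝ᵥ (A *ᵥ y) = - (y ⬝ᵥ (A *ᵥ x)) := by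
  rw [Matrix.dotProduct_mulVec, ← Matrix.mulVec_transpose, hA, Matrix.neg_mulVec, neg_dotProduct,
    dotProduct_comm]

lemma skew_dotProduct_self {A : Matrix (Fin d) (Fin d) ℝ} (hA : Aᵀ = -A) (x : Fin d → ℝ) :
    x ⬝ᵥ (A *ᵥ x) = 0 := by
  have := skew_dotProduct hA x x
  linarith

/-- An infinitesimal isometry vanishing on `d` affinely independent points vanishes. -/
lemma AffIndepOn.skew_eq_zero {p : α → Fin d → ℝ} {U : Finset α} (h : AffIndepOn p U)
    (hU : U.card = d) {A : Matrix (Fin d) (Fin d) ℝ} (hA : Aᵀ = -A) {t : Fin d → ℝ}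
    (h0 : ∀ i ∈ U, A *ᵥ p i + t = 0) (x : Fin d → ℝ) : A *ᵥ x + t = 0 := by
  let M : ((Fin d → ℝ) × ℝ) →ₗ[ℝ] (Fin d → ℝ) :=
    (Matrix.mulVecLin A) ∘ₗ LinearMap.fst ℝ _ _ + (LinearMap.snd ℝ _ _).smulRight t
  have hM : ∀ x s, M (x, s) = A *ᵥ x + s • t := fun x s => by simp [M]
  have hle : Submodule.span ℝ (homog p '' (U : Set α)) ≤ LinearMap.ker M := by
    rw [Submodule.span_le]
    rintro _ ⟨i, hi, rfl⟩
    simp [homog, hM, h0 i (by simpa using hi)]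
  -- The kernel contains a d-dimensional subspace of a (d+1)-dimensional space, so `A` has rank at
  -- most one. A skew-symmetric matrix of rank at most one is zero: if A x spans the range, then x ⬝
  -- A x = 0 makes x orthogonal to the range, whence |A x|² = -(x ⬝ A (A x)) = 0.
  have hr : Module.finrank ℝ (LinearMap.range M) ≤ 1 := by
    have h1 := Submodule.finrank_mono hle
    rw [h.finrank_span, hU] at h1
    have h2 := LinearMap.finrank_range_add_finrank_ker M
    simp at h2
    omega
  have hA0 : ∀ x, A *ᵥ x = 0 := by
    intro x
    by_contra hx
    obtain ⟨⟨v, _⟩, hv⟩ := finrank_le_one_iff.1 hr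
    have hmul : ∀ z, ∃ c : ℝ, c • v = A *ᵥ z := fun z => by
      obtain ⟨c, hc⟩ := hv ⟨A *ᵥ z, (z, 0), by simp [hM]⟩
      exact ⟨c, congrArg Subtype.val hc⟩
    obtain ⟨a, ha⟩ := hmul x
    obtain ⟨b, hb⟩ := hmul (A *ᵥ x)
    have ha0 : a ≠ 0 := by
      rintro rfl
      exact hx (by rw [← ha, zero_smul])
    have h1 := skew_dotProduct_self hA x
    have h2 := skew_dotProduct hA x (A *ᵥ x)
    rw [← ha, dotProduct_smul, smul_eq_mul, mul_eq_zero, or_iff_right ha0] at h1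
    rw [← hb, dotProduct_smul, h1, smul_zero, zero_eq_neg, dotProduct_self_eq_zero] at h2
    exact hx h2
  rw [hA0, zero_add]
  rcases U.eq_empty_or_nonempty with rfl | ⟨i, hi⟩
  · rw [Finset.card_empty] at hU
    subst hU
    exact Subsingleton.elim _ _
  · rw [← h0 i hi, hA0, zero_add]

/-- Infinitesimal motions of a simplex with affinely independent vertices are trivial. -/
lemma AffIndepOn.exists_skew [DecidableEq α] {p q : α → Fin d → ℝ} {U : Finset α}
    (h : AffIndepOn p U) (hq : ∀ i ∈ U, ∀ j ∈ U, (p i - p j) ⬝ᵥ (q i - q j) = 0) :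
    ∃ (A : Matrix (Fin d) (Fin d) ℝ) (t : Fin d → ℝ), Aᵀ = -A ∧ ∀ i ∈ U, q i = A *ᵥ p i + t := by
  induction U using Finset.induction_on with
  | empty => exact ⟨0, 0, by simp, by simp⟩
  | insert w U hw ih =>
    obtain ⟨hU, hs⟩ := (affIndepOn_insert hw).1 h
    obtain ⟨A, t, hA, ht⟩ := ih hU fun i hi j hj =>
      hq i (Finset.mem_insert_of_mem hi) j (Finset.mem_insert_of_mem hj)
    obtain ⟨f, hf0, hf⟩ := Submodule.exists_le_ker_of_notMem hs
    obtain ⟨n, c, hn⟩ := exists_dotProduct_eq f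
    set y := q w - (A *ᵥ p w + t) with hy
    have hyU : ∀ i ∈ U, y ⬝ᵥ p i = y ⬝ᵥ p w := by
      intro i hi
      have h1 := hq w (Finset.mem_insert_self _ _) i (Finset.mem_insert_of_mem hi)
      rw [ht i hi] at h1
      have h2 := skew_dotProduct_self hA (p w - p i)
      have h3 : q w - (A *ᵥ p i + t) = y + A *ᵥ (p w - p i) := by
        rw [hy, Matrix.mulVec_sub]; abel
      rw [h3, dotProduct_add, h2, add_zero, dotProduct_comm, dotProduct_sub] at h1
      linarith
    have hfw : f (homog p w) = n ⬝ᵥ p w + c := by simp [homog, hn]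
    have hfU : ∀ i ∈ U, n ⬝ᵥ p i + c = 0 := by
      intro i hi
      have : f (homog p i) = 0 := hf (Submodule.subset_span ⟨i, by simpa using hi, rfl⟩)
      simpa [homog, hn] using this
    set e := f (homog p w) with he
    -- The error `y` at `w` is corrected by a rank-two skew matrix built from `y` and the normal `n`
    -- of a hyperplane through `U` missing `w`. The correction vanishes on `U`, because `y` has the
    -- same inner product with all the points involved, and equals `y` at `w`.
    refine ⟨A + e⁻¹ • (Matrix.vecMulVec y n - Matrix.vecMulVec n y),
      t + e⁻¹ • (c • y + (y ⬝ᵥ p w) • n), ?_, ?_⟩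
    · rw [Matrix.transpose_add, hA, Matrix.transpose_smul, Matrix.transpose_sub,
        Matrix.transpose_vecMulVec, Matrix.transpose_vecMulVec, neg_add, ← smul_neg, neg_sub]
    · have key : ∀ x, (A + e⁻¹ • (Matrix.vecMulVec y n - Matrix.vecMulVec n y)) *ᵥ x +
          (t + e⁻¹ • (c • y + (y ⬝ᵥ p w) • n)) = (A *ᵥ x + t) +
            e⁻¹ • ((n ⬝ᵥ x + c) • y + (y ⬝ᵥ p w - y ⬝ᵥ x) • n) := by
        intro x
        rw [Matrix.add_mulVec, Matrix.smul_mulVec, Matrix.sub_mulVec, Matrix.vecMulVec_mulVec,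
          Matrix.vecMulVec_mulVec]
        ext i
        simp
        ring
      intro i hi
      rw [key]
      rcases Finset.mem_insert.1 hi with rfl | hi
      · rw [← hfw, sub_self, zero_smul, add_zero, smul_smul, inv_mul_cancel₀ hf0, one_smul, hy]
        abel
      · rw [hfU i hi, hyU i hi, ht i hi]; simp

end AffineIndependence

/-! ### Genericity along lines. -/

section LineOpen

variable {M : Type*} [AddCommGroup M] [Module ℝ M]

/-- On every line, `P` holds either nowhere or at all but finitely many points. -/
def IsLineOpen (P : M → Prop) : Prop :=
  ∀ p, P p → ∀ r, {t : ℝ | ¬ P (p + t • r)}.Finite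

/-- On the line joining a point with `P` to a point with `Q`, each property fails only finitely
often, and the line stays in `E`. -/
lemma IsLineOpen.exists_and {P Q : M → Prop} (hP : IsLineOpen P) (hQ : IsLineOpen Q)
    {E : Submodule ℝ M} (h1 : ∃ p ∈ E, P p) (h2 : ∃ p ∈ E, Q p) : ∃ p ∈ E, P p ∧ Q p := by
  obtain ⟨a, haE, ha⟩ := h1
  obtain ⟨b, hbE, hb⟩ := h2
  have hf1 := hP a ha (b - a)
  have hf2 := (hQ b hb (a - b)).preimage (f := fun t : ℝ => 1 - t)
    (fun x _ y _ h => by simpa using h)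
  obtain ⟨t, -, ht⟩ := Set.infinite_univ.exists_notMem_finite (hf1.union hf2)
  simp only [Set.mem_union, Set.mem_ofPred_eq, Set.mem_preimage, not_or, not_not] at ht
  refine ⟨a + t • (b - a), E.add_mem haE (E.smul_mem _ (E.sub_mem hbE haE)), ht.1, ?_⟩
  convert ht.2 using 1
  module

lemma IsLineOpen.and {P Q : M → Prop} (hP : IsLineOpen P) (hQ : IsLineOpen Q) :
    IsLineOpen fun p => P p ∧ Q p := fun p hp r =>
  ((hP p hp.1 r).union (hQ p hp.2 r)).subset fun _ ht => not_and_or.1 ht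

/-- With `h` a left inverse of `f`, a nonzero kernel vector x of f + t g satisfies x = -t h(g x).
Thus -1/t is one of the finitely many eigenvalues of h ∘ g. -/
lemma finite_setOf_not_injective {E F : Type*} [AddCommGroup E] [Module ℝ E]
    [FiniteDimensional ℝ E] [AddCommGroup F] [Module ℝ F] (f g : E →ₗ[ℝ] F)
    (hf : Function.Injective f) : {t : ℝ | ¬ Function.Injective (f + t • g)}.Finite := by
  obtain ⟨h, hh⟩ := f.exists_leftInverse_of_injective (LinearMap.ker_eq_bot.2 hf)
  refine ((Module.End.finite_hasEigenvalue (h ∘ₗ g)).image fun μ => -μ⁻¹).subset fun t ht => ?_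
  rw [Set.mem_ofPred_eq, ← LinearMap.ker_eq_bot, Submodule.eq_bot_iff] at ht
  push Not at ht
  obtain ⟨x, hx, hx0⟩ := ht
  have h1 : x + t • h (g x) = 0 := by
    have h2 := congrArg h (LinearMap.mem_ker.1 hx)
    have h3 : h (f x) = x := congrArg (fun l => l x) hh
    simpa [h3] using h2
  have ht0 : t ≠ 0 := by
    rintro rfl
    exact hx0 (by simpa using h1)
  refine ⟨-t⁻¹, ?_, by simp⟩
  refine Module.End.hasEigenvalue_of_hasEigenvector (x := x) ⟨?_, hx0⟩
  rw [Module.End.mem_eigenspace_iff, LinearMap.comp_apply]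
  rw [add_comm, add_eq_zero_iff_eq_neg] at h1
  rw [neg_smul, ← smul_neg, ← h1, smul_smul, inv_mul_cancel₀ ht0, one_smul]

lemma AffIndepOn.isLineOpen {α : Type*} {d : ℕ} (Q : Finset α) :
    IsLineOpen fun p : α → Fin d → ℝ => AffIndepOn p Q := by
  intro p hp r
  have h0 := linearIndependent_iff_injective_fintypeLinearCombination.1
    (show LinearIndependent ℝ (fun i : (Q : Set α) => homog p i) from hp)
  refine (finite_setOf_not_injective _
    -- The last coordinate is 0 because the homogenising 1 does not move along the line.
    (Fintype.linearCombination ℝ fun i : (Q : Set α) => (r i, (0 : ℝ))) h0).subset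
      fun t ht hinj => ht ?_
  refine linearIndependent_iff_injective_fintypeLinearCombination.2 ?_
  convert hinj using 2
  refine LinearMap.ext fun x => ?_
  rw [LinearMap.add_apply, LinearMap.smul_apply, Fintype.linearCombination_apply,
    Fintype.linearCombination_apply, Fintype.linearCombination_apply, Finset.smul_sum,
    ← Finset.sum_add_distrib]
  refine Finset.sum_congr rfl fun i _ => ?_
  ext <;> simp [homog]
  ring

end LineOpen

/-! ### Rigidity on a vertex set: pinning, gluing, vertex addition and vertex splitting. -/

section RigidOn

variable {α : Type*} {d : ℕ}

/-- `q` satisfies the equations of an infinitesimal motion at the edges of `G` inside `W`. -/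
def IsMotionOn (G : SimpleGraph α) (W : Finset α) (p q : α → Fin d → ℝ) : Prop :=
  ∀ i ∈ W, ∀ j ∈ W, G.Adj i j → (p i - p j) ⬝ᵥ (q i - q j) = 0

/-- `q` coincides on `W` with a trivial motion of `p`. -/
def IsTrivialOn (W : Finset α) (p q : α → Fin d → ℝ) : Prop :=
  ∃ (A : Matrix (Fin d) (Fin d) ℝ) (t : Fin d → ℝ), Aᵀ = -A ∧ ∀ i ∈ W, q i = A *ᵥ p i + t

/-- The subgraph of `G` induced by `W` is infinitesimally rigid at `p` and has a `d`-clique with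
affinely independent vertices. -/
def RigidOn (G : SimpleGraph α) (W : Finset α) (p : α → Fin d → ℝ) : Prop :=
  (∃ U ⊆ W, U.card = d ∧ G.IsClique U ∧ AffIndepOn p U) ∧
    ∀ q, IsMotionOn G W p q → IsTrivialOn W p q

lemma IsMotionOn.mono {G : SimpleGraph α} {W W' : Finset α} {p q : α → Fin d → ℝ}
    (h : IsMotionOn G W' p q) (hW : W ⊆ W') : IsMotionOn G W p q :=
  fun i hi j hj => h i (hW hi) j (hW hj)

lemma IsMotionOn.sub_trivial {G : SimpleGraph α} {W : Finset α} {p q : α → Fin d → ℝ}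
    (h : IsMotionOn G W p q) {A : Matrix (Fin d) (Fin d) ℝ} (hA : Aᵀ = -A) (t : Fin d → ℝ) :
    IsMotionOn G W p fun i => q i - (A *ᵥ p i + t) := by
  intro i hi j hj hij
  have h1 : q i - (A *ᵥ p i + t) - (q j - (A *ᵥ p j + t)) = (q i - q j) - A *ᵥ (p i - p j) := by
    rw [Matrix.mulVec_sub]; abel
  simp only [h1]
  rw [dotProduct_sub, h i hi j hj hij, skew_dotProduct_self hA, sub_zero]

/-- The rigidity map of `(G, p)` restricted to `W`. -/
noncomputable def edgeMap (G : SimpleGraph α) (W : Finset α) (p : α → Fin d → ℝ) :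
    (W → Fin d → ℝ) →ₗ[ℝ] ({e : W × W // G.Adj e.1 e.2} → ℝ) :=
  LinearMap.pi fun e => (dotProductEquiv ℝ (Fin d) (p e.1.1 - p e.1.2)) ∘ₗ
    ((LinearMap.proj e.1.1 : (W → Fin d → ℝ) →ₗ[ℝ] (Fin d → ℝ)) - LinearMap.proj e.1.2)

lemma edgeMap_apply (G : SimpleGraph α) (W : Finset α) (p : α → Fin d → ℝ) (q : W → Fin d → ℝ)
    (e : {e : W × W // G.Adj e.1 e.2}) :
    edgeMap G W p q e = (p e.1.1 - p e.1.2) ⬝ᵥ (q e.1.1 - q e.1.2) := by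
  rfl

lemma edgeMap_add_smul (G : SimpleGraph α) (W : Finset α) (p r : α → Fin d → ℝ) (t : ℝ) :
    edgeMap G W (p + t • r) = edgeMap G W p + t • edgeMap G W r := by
  refine LinearMap.ext fun q => funext fun e => ?_
  simp only [LinearMap.add_apply, LinearMap.smul_apply, Pi.add_apply, Pi.smul_apply,
    edgeMap_apply, smul_eq_mul]
  rw [← smul_eq_mul, ← smul_dotProduct, ← add_dotProduct]
  congr 1
  module

lemma prod_apply_eq_zero_iff {E F F' : Type*} [AddCommGroup E] [Module ℝ E]
    [AddCommGroup F] [Module ℝ F] [AddCommGroup F'] [Module ℝ F'] (f : E →ₗ[ℝ] F)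
    (g : E →ₗ[ℝ] F') (x : E) : f.prod g x = 0 ↔ f x = 0 ∧ g x = 0 :=
  Prod.mk_eq_zero

/-- `K` collects the linear conditions that remove trivial motions: pinning a clique, and in
`RigidOn.split` one further equation. -/
lemma injective_edgeMap_prod_iff {F : Type*} [AddCommGroup F] [Module ℝ F] (G : SimpleGraph α)
    (W : Finset α) (K : (W → Fin d → ℝ) →ₗ[ℝ] F) (p : α → Fin d → ℝ) :
    Function.Injective ((edgeMap G W p).prod K) ↔
      ∀ q : α → Fin d → ℝ, IsMotionOn G W p q → K (fun i => q i) = 0 → ∀ i ∈ W, q i = 0 := by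
  classical
  rw [← LinearMap.ker_eq_bot, Submodule.eq_bot_iff]
  constructor
  · intro h q hq hK i hi
    refine congrFun (h (fun i => q i) ?_) ⟨i, hi⟩
    rw [LinearMap.mem_ker, prod_apply_eq_zero_iff]
    refine ⟨funext fun e => ?_, hK⟩
    rw [edgeMap_apply]
    exact hq _ e.1.1.2 _ e.1.2.2 e.2
  · intro h q hq
    rw [LinearMap.mem_ker, prod_apply_eq_zero_iff] at hq
    let q' : α → Fin d → ℝ := fun i => if hi : i ∈ W then q ⟨i, hi⟩ else 0
    have hq' : ∀ i : W, q' i = q i := fun i => by simp [q']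
    funext i
    rw [← hq']
    refine h q' (fun i hi j hj hij => ?_) ?_ i i.2
    · have := congrFun hq.1 ⟨(⟨i, hi⟩, ⟨j, hj⟩), hij⟩
      rw [edgeMap_apply] at this
      rw [hq' ⟨i, hi⟩, hq' ⟨j, hj⟩]
      exact this
    · rw [← hq.2]
      congr 1
      exact funext hq'

lemma isLineOpen_injective_edgeMap {F : Type*} [AddCommGroup F] [Module ℝ F]
    (G : SimpleGraph α) (W : Finset α) (K : (W → Fin d → ℝ) →ₗ[ℝ] F) :
    IsLineOpen fun p : α → Fin d → ℝ => Function.Injective ((edgeMap G W p).prod K) := by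
  intro p hp r
  refine (finite_setOf_not_injective _ ((edgeMap G W r).prod 0) hp).subset fun t ht hinj => ht ?_
  convert hinj using 2
  refine LinearMap.ext fun q => ?_
  simp [edgeMap_add_smul]

/-- Restriction of velocities from `W` to `U`. -/
def pinMap {U W : Finset α} (hU : U ⊆ W) : (W → Fin d → ℝ) →ₗ[ℝ] (U → Fin d → ℝ) :=
  LinearMap.funLeft ℝ _ fun i : U => (⟨i, hU i.2⟩ : W)

lemma pinMap_eq_zero {U W : Finset α} (hU : U ⊆ W) (q : α → Fin d → ℝ) :
    pinMap hU (fun i => q i) = 0 ↔ ∀ i ∈ U, q i = 0 := by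
  constructor
  · exact fun h i hi => congrFun h ⟨i, hi⟩
  · exact fun h => funext fun i => h i i.2

lemma IsTrivialOn.eq_zero {U W : Finset α} (hU : U ⊆ W) (hcard : U.card = d)
    {p q : α → Fin d → ℝ} (hind : AffIndepOn p U) (h : IsTrivialOn W p q)
    (h0 : ∀ i ∈ U, q i = 0) : ∀ i ∈ W, q i = 0 := by
  obtain ⟨A, t, hA, ht⟩ := h
  intro i hi
  rw [ht i hi]
  exact hind.skew_eq_zero hcard hA (fun j hj => by rw [← ht j (hU hj), h0 j hj]) _

/-- To test rigidity it is enough to consider motions vanishing on a `d`-clique. -/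
lemma rigidOn_of_pinned {G : SimpleGraph α} {U W : Finset α} (hU : U ⊆ W) (hcard : U.card = d)
    (hclique : G.IsClique U) {p : α → Fin d → ℝ} (hind : AffIndepOn p U)
    (h : ∀ q, IsMotionOn G W p q → (∀ i ∈ U, q i = 0) → ∀ i ∈ W, q i = 0) : RigidOn G W p := by
  classical
  refine ⟨⟨U, hU, hcard, hclique, hind⟩, fun q hq => ?_⟩
  obtain ⟨A, t, hA, ht⟩ := hind.exists_skew (q := q) fun i hi j hj => by
    by_cases hij : i = j
    · simp [hij]
    · exact hq i (hU hi) j (hU hj) (hclique hi hj hij)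
  refine ⟨A, t, hA, fun i hi => ?_⟩
  have := h _ (hq.sub_trivial hA t) (fun i hi => by simp [ht i hi]) i hi
  exact sub_eq_zero.1 this

/-- Subtracting a trivial motion makes any motion vanish on the clique, and a trivial motion
vanishing there is zero. Rigidity thus becomes injectivity of a map affine in `p`, which is
line-open; this is why `RigidOn` carries a `d`-clique. -/
lemma rigidOn_iff_injective {G : SimpleGraph α} {U W : Finset α} (hU : U ⊆ W) (hcard : U.card = d)
    (hclique : G.IsClique U) {p : α → Fin d → ℝ} (hind : AffIndepOn p U) :
    RigidOn G W p ↔ Function.Injective ((edgeMap G W p).prod (pinMap hU)) := by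
  rw [injective_edgeMap_prod_iff]
  simp only [pinMap_eq_zero]
  exact ⟨fun h q hq h0 => (h.2 q hq).eq_zero hU hcard hind h0,
    fun h => rigidOn_of_pinned hU hcard hclique hind h⟩

lemma RigidOn.isLineOpen (G : SimpleGraph α) (W : Finset α) :
    IsLineOpen fun p : α → Fin d → ℝ => RigidOn G W p := by
  intro p hp r
  obtain ⟨U, hU, hcard, hclique, hind⟩ := hp.1
  refine ((AffIndepOn.isLineOpen U).and (isLineOpen_injective_edgeMap G W (pinMap hU)) p
    ⟨hind, (rigidOn_iff_injective hU hcard hclique hind).1 hp⟩ r).subset fun t ht h => ht ?_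
  exact (rigidOn_iff_injective hU hcard hclique h.1).2 h.2

lemma RigidOn.congr {G : SimpleGraph α} {W : Finset α} {p p' : α → Fin d → ℝ}
    (h : RigidOn G W p) (hp : ∀ i ∈ W, p i = p' i) : RigidOn G W p' := by
  obtain ⟨⟨U, hU, hcard, hclique, hind⟩, h⟩ := h
  refine ⟨⟨U, hU, hcard, hclique, hind.congr fun i hi => hp i (hU hi)⟩, fun q hq => ?_⟩
  obtain ⟨A, t, hA, ht⟩ := h q fun i hi j hj hij => by
    rw [hp i hi, hp j hj]; exact hq i hi j hj hij
  exact ⟨A, t, hA, fun i hi => by rw [← hp i hi, ht i hi]⟩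

lemma rigidOn_clique {G : SimpleGraph α} {U : Finset α} (hcard : U.card = d)
    (hclique : G.IsClique U) {p : α → Fin d → ℝ} (hind : AffIndepOn p U) : RigidOn G U p :=
  rigidOn_of_pinned subset_rfl hcard hclique hind fun _ _ h => h

variable [DecidableEq α]

/-- A motion pinned on a clique of `W₁` vanishes on `W₁`, hence on `U`, hence on `W₂`. The shared
set `U` need not be a clique. -/
lemma RigidOn.union {G : SimpleGraph α} {W₁ W₂ U : Finset α} {p : α → Fin d → ℝ}
    (h₁ : RigidOn G W₁ p) (h₂ : RigidOn G W₂ p) (hU₁ : U ⊆ W₁) (hU₂ : U ⊆ W₂) (hcard : U.card = d)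
    (hind : AffIndepOn p U) : RigidOn G (W₁ ∪ W₂) p := by
  obtain ⟨⟨U₀, hU, hcard₀, hclique, hind₀⟩, h₁⟩ := h₁
  refine rigidOn_of_pinned (hU.trans Finset.subset_union_left) hcard₀ hclique hind₀ fun q hq h0 => ?_
  have hW₁ := (h₁ q (hq.mono Finset.subset_union_left)).eq_zero hU hcard₀ hind₀ h0
  have hW₂ := (h₂.2 q (hq.mono Finset.subset_union_right)).eq_zero hU₂ hcard hind
    fun i hi => hW₁ i (hU₁ hi)
  intro i hi
  exact (Finset.mem_union.1 hi).elim (hW₁ i) (hW₂ i)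

/-- Attaching a vertex to `d` vertices in general position. -/
lemma RigidOn.insert_vertex {G : SimpleGraph α} {W N : Finset α} {w : α} {p : α → Fin d → ℝ}
    (h : RigidOn G W p) (hN : N ⊆ W) (hcard : N.card = d) (hadj : ∀ n ∈ N, G.Adj n w)
    (hind : AffIndepOn p (insert w N)) : RigidOn G (insert w W) p := by
  have hwN : w ∉ N := fun hw => (hadj w hw).ne rfl
  obtain ⟨⟨U₀, hU, hcard₀, hclique, hind₀⟩, h⟩ := h
  refine rigidOn_of_pinned (hU.trans (Finset.subset_insert _ _)) hcard₀ hclique hind₀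
    fun q hq h0 => ?_
  have hW := (h q (hq.mono (Finset.subset_insert _ _))).eq_zero hU hcard₀ hind₀ h0
  have hw : q w = 0 := by
    refine hind.eq_zero (by rw [Finset.card_insert_of_notMem hwN, hcard]) (m := q w ⬝ᵥ p w) ?_
    intro i hi
    rcases Finset.mem_insert.1 hi with rfl | hi
    · rfl
    have h1 := hq w (Finset.mem_insert_self _ _) i (Finset.mem_insert_of_mem (hN hi))
      (hadj i hi).symm
    rw [hW i (hN hi), sub_zero, dotProduct_comm, dotProduct_sub] at h1
    linarith
  intro i hi
  rcases Finset.mem_insert.1 hi with rfl | hi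
  exacts [hw, hW i hi]

/-- Vertex splitting. -/
lemma RigidOn.split {G H : SimpleGraph α} {W C U : Finset α} {u v : α} {p : α → Fin d → ℝ}
    (h : RigidOn H W p) (hv : v ∉ W) (hu : u ∈ W) (huv : G.Adj u v)
    (hH : ∀ a ∈ W, ∀ b ∈ W, H.Adj a b →
      G.Adj a b ∨ (a = u ∧ G.Adj v b) ∨ (b = u ∧ G.Adj a v))
    (hC : C ⊆ W) (hCadj : ∀ c ∈ C, G.Adj c u ∧ G.Adj c v) (hCcard : C.card + 1 = d)
    (hCind : AffIndepOn p (insert u C)) (hU : U ⊆ W) (hUcard : U.card = d)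
    (hUclique : G.IsClique U) (hUind : AffIndepOn p U) :
    ∃ a : Fin d → ℝ, RigidOn G (insert v W) (Function.update p v a) := by
  have huC : u ∉ C := fun hw => (hCadj u hw).1.ne rfl
  have hWv : ∀ i ∈ W, i ≠ v := fun i hi h => hv (h ▸ hi)
  -- `z` leaves the hyperplane through `u` and `C`; the new vertex will be placed at p u + t z.
  obtain ⟨a, ha⟩ := exists_notMem_span p (insert u C)
    (by rw [Finset.card_insert_of_notMem huC, hCcard])
  set z := a - p u with hz
  set p₀ := Function.update p v (p u) with hp₀
  have hp₀W : ∀ i ∈ W, p₀ i = p i := fun i hi => Function.update_of_ne (hWv i hi) _ _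
  have hp₀v : p₀ v = p u := Function.update_self _ _ _
  let v' : (insert v W : Finset α) := ⟨v, Finset.mem_insert_self _ _⟩
  let u' : (insert v W : Finset α) := ⟨u, Finset.mem_insert_of_mem hu⟩
  have hU' : U ⊆ insert v W := hU.trans (Finset.subset_insert _ _)
  let K : (↥(insert v W) → Fin d → ℝ) →ₗ[ℝ] ℝ × (U → Fin d → ℝ) :=
    ((dotProductEquiv ℝ (Fin d) z) ∘ₗ
      ((LinearMap.proj v' : (↥(insert v W) → Fin d → ℝ) →ₗ[ℝ] (Fin d → ℝ)) -
        LinearMap.proj u')).prod (pinMap hU')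
  have hK : ∀ q : α → Fin d → ℝ, K (fun i => q i) = 0 ↔
      z ⬝ᵥ (q v - q u) = 0 ∧ ∀ i ∈ U, q i = 0 := by
    intro q
    rw [← pinMap_eq_zero hU', ← Prod.mk_eq_zero]
    simp [K, u', v']
  -- In the degenerate framework `v` lies on top of `u` and the edge uv imposes nothing. It is
  -- replaced by z ⬝ (q v - q u) = 0, which is what its equation becomes at p u + t z after division
  -- by t.
  have hinj : Function.Injective ((edgeMap (G.deleteEdges {s(u, v)}) (insert v W) p₀).prod K) := by
    rw [injective_edgeMap_prod_iff]
    intro q hq hKq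
    rw [hK] at hKq
    obtain ⟨hzq, hqU⟩ := hKq
    have hq' : ∀ i ∈ insert v W, ∀ j ∈ insert v W, G.Adj i j → s(i, j) ≠ s(u, v) →
        (p₀ i - p₀ j) ⬝ᵥ (q i - q j) = 0 := fun i hi j hj hij hne =>
      hq i hi j hj (by simpa [SimpleGraph.deleteEdges_adj] using ⟨hij, by simpa using hne⟩)
    -- The difference is orthogonal to `z` and to each p c - p u with c in `C`, and these d vectors
    -- span. Hence `q` moves `u` and `v` together and restricts to a motion of `H`.
    have huvq : q v - q u = 0 := by
      have hind : AffIndepOn (Function.update p v a) (insert v (insert u C)) := by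
        have hvn : v ∉ insert u C := by
          rw [Finset.mem_insert, not_or]
          exact ⟨(hWv u hu).symm, fun h => hv (hC h)⟩
        have hagree : ∀ i ∈ insert u C, p i = Function.update p v a i := fun i hi =>
          (Function.update_of_ne (by rintro rfl; exact hvn hi) _ _).symm
        rw [affIndepOn_insert hvn]
        refine ⟨hCind.congr hagree, ?_⟩
        rw [homog, Function.update_self]
        convert ha using 3
        refine Set.image_congr fun i hi => ?_
        rw [homog, homog, hagree i (by exact_mod_cast hi)]
      refine hind.eq_zero (m := (q v - q u) ⬝ᵥ p u) ?_ ?_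
      · rw [Finset.card_insert_of_notMem, Finset.card_insert_of_notMem huC, hCcard]
        rw [Finset.mem_insert, not_or]
        exact ⟨(hWv u hu).symm, fun h => hv (hC h)⟩
      · intro i hi
        rw [Finset.mem_insert, Finset.mem_insert] at hi
        rcases hi with rfl | rfl | hi
        · rw [Function.update_self]
          rw [hz, dotProduct_comm, dotProduct_sub] at hzq
          linarith
        · rw [Function.update_of_ne (hWv i hu)]
        · have hiW := hC hi
          rw [Function.update_of_ne (hWv i hiW)]
          have h1 := hq' i (Finset.mem_insert_of_mem hiW) u (Finset.mem_insert_of_mem hu)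
            (hCadj i hi).1 (by
              have := hWv i hiW; have := hWv u hu
              simp; tauto)
          have h2 := hq' i (Finset.mem_insert_of_mem hiW) v (Finset.mem_insert_self _ _)
            (hCadj i hi).2 (by
              have := hWv i hiW; have := hWv u hu; have := (hCadj i hi).1.ne
              simp; tauto)
          rw [hp₀W i hiW, hp₀W u hu] at h1
          rw [hp₀W i hiW, hp₀v] at h2
          have h3 : (p i - p u) ⬝ᵥ (q v - q u) = 0 := by
            have : q v - q u = (q i - q u) - (q i - q v) := by abel
            rw [this, dotProduct_sub, h1, h2, sub_zero]
          rw [dotProduct_comm, dotProduct_sub] at h3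
          linarith
    have hqv : q v = q u := sub_eq_zero.1 huvq
    have hqH : IsMotionOn H W p q := by
      intro i hi j hj hij
      rcases hH i hi j hj hij with h1 | ⟨rfl, h1⟩ | ⟨rfl, h1⟩
      · have := hq' i (Finset.mem_insert_of_mem hi) j (Finset.mem_insert_of_mem hj) h1 (by
          have := hWv i hi; have := hWv j hj
          simp; tauto)
        rwa [hp₀W i hi, hp₀W j hj] at this
      · have := hq' v (Finset.mem_insert_self _ _) j (Finset.mem_insert_of_mem hj) h1 (by
          have := hWv i hi; have := hWv j hj; have := hij.ne
          simp; tauto)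
        rwa [hp₀v, hp₀W j hj, hqv] at this
      · have := hq' i (Finset.mem_insert_of_mem hi) v (Finset.mem_insert_self _ _) h1 (by
          have := hWv i hi; have := hWv j hj; have := hij.ne
          simp; tauto)
        rwa [hp₀v, hp₀W i hi, hqv] at this
    have hW := (h.2 q hqH).eq_zero hU hUcard hUind hqU
    intro i hi
    rcases Finset.mem_insert.1 hi with rfl | hi
    exacts [hqv.trans (hW u hu), hW i hi]
  -- Moving only `v` along `z` preserves injectivity for almost all t; t = 0 is also excluded so
  -- that the equation of uv can be divided by t.
  have hfin := isLineOpen_injective_edgeMap _ _ K p₀ hinj (Pi.single v z)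
  obtain ⟨t, -, ht⟩ := Set.infinite_univ.exists_notMem_finite (hfin.union (Set.finite_singleton 0))
  simp only [Set.mem_union, Set.mem_ofPred_eq, Set.mem_singleton_iff, not_or, not_not] at ht
  obtain ⟨ht, ht0⟩ := ht
  have hpt : p₀ + t • (Pi.single v z : α → Fin d → ℝ) = Function.update p v (p u + t • z) := by
    funext i
    by_cases hi : i = v
    · subst hi; simp [hp₀]
    · simp [hp₀, hi]
  rw [hpt, injective_edgeMap_prod_iff] at ht
  refine ⟨p u + t • z, rigidOn_of_pinned hU' hUcard hUclique
    (hUind.congr fun i hi => (Function.update_of_ne (hWv i (hU hi)) _ _).symm) fun q hq h0 => ?_⟩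
  refine ht q (fun i hi j hj hij => hq i hi j hj (SimpleGraph.deleteEdges_le _ hij))
    ((hK q).2 ⟨?_, h0⟩)
  have := hq v (Finset.mem_insert_self _ _) u (Finset.mem_insert_of_mem hu) huv.symm
  rw [Function.update_self, Function.update_of_ne (hWv u hu), add_sub_cancel_left,
    smul_dotProduct, smul_eq_mul, mul_eq_zero, or_iff_right ht0] at this
  exact this

end RigidOn

/-! ### Symmetric configurations and symmetric versions of the rigidity moves. -/

section Symmetric

variable {α : Type*} {d : ℕ} {γ : Matrix (Fin d) (Fin d) ℝ} {σ : α → α}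

/-- The configurations with `p (σ x) = γ (p x)` whenever `σ` moves `x`. -/
def symConfigs (γ : Matrix (Fin d) (Fin d) ℝ) (σ : α → α) : Submodule ℝ (α → Fin d → ℝ) where
  carrier := {p | ∀ x, σ x ≠ x → p (σ x) = γ *ᵥ p x}
  add_mem' := fun {p q} hp hq x hx => by
    rw [Pi.add_apply, Pi.add_apply, hp x hx, hq x hx, Matrix.mulVec_add]
  zero_mem' := fun x _ => by simp
  smul_mem' := fun c p hp x hx => by
    rw [Pi.smul_apply, Pi.smul_apply, hp x hx, Matrix.mulVec_smul]

/-- `Q` contains at most one pair `{x, σ x}` with `σ x ≠ x`. -/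
def AtMostOnePair (σ : α → α) (Q : Finset α) : Prop :=
  ∃ x₀, ∀ y ∈ Q, σ y ∈ Q → σ y ≠ y → y = x₀ ∨ σ y = x₀

/-- `G` is rigid on `W` in some symmetric configuration. -/
def SymRigid (γ : Matrix (Fin d) (Fin d) ℝ) (σ : α → α) (G : SimpleGraph α) (W : Finset α) :
    Prop :=
  ∃ p ∈ symConfigs γ σ, RigidOn G W p

lemma atMostOnePair_of_isClique [Nonempty α] {G : SimpleGraph α} {Q : Finset α}
    (hQ : G.IsClique Q) (hG : ∀ x, ¬ G.Adj x (σ x)) : AtMostOnePair σ Q :=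
  ⟨Classical.arbitrary α, fun y hy hσy hne => absurd (hQ hy hσy hne.symm) (hG y)⟩

/-- The involution agreeing with `σ` on the pairs contained in `W`. -/
def restrictInvolution [DecidableEq α] (σ : α → α) (W : Finset α) (x : α) : α :=
  if x ∈ W ∧ σ x ∈ W then σ x else x

variable [DecidableEq α]

/-- No partner of `y` lies in `Q`, so `y` and `σ y` can be repositioned together without disturbing
`Q`. -/
lemma exists_insert_affIndepOn (hσ : Function.Involutive σ) (hγ : ∀ x, γ *ᵥ (γ *ᵥ x) = x)
    {p : α → Fin d → ℝ} (hp : p ∈ symConfigs γ σ) {Q : Finset α} (hQ : AffIndepOn p Q) {y : α}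
    (hy : y ∉ Q) (hσy : σ y = y ∨ σ y ∉ Q) (hcard : Q.card ≤ d) :
    ∃ p' ∈ symConfigs γ σ, AffIndepOn p' (insert y Q) := by
  obtain ⟨a, ha⟩ := exists_notMem_span p Q hcard
  let p' : α → Fin d → ℝ := fun x => if x = y then a else if x = σ y then γ *ᵥ a else p x
  have hp'Q : ∀ i ∈ Q, p i = p' i := by
    intro i hi
    have h1 : i ≠ y := by rintro rfl; exact hy hi
    have h2 : i ≠ σ y := by
      rintro rfl
      rcases hσy with h | h
      · exact h1 h
      · exact h hi
    simp [p', h1, h2]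
  refine ⟨p', fun x hx => ?_, (affIndepOn_insert hy).2 ⟨hQ.congr hp'Q, ?_⟩⟩
  · by_cases h1 : x = y
    · subst h1
      simp [p', hx]
    by_cases h2 : x = σ y
    · subst h2
      have : σ (σ y) = y := hσ y
      simp [p', this, h1, hγ]
    · have h3 : σ x ≠ y := fun h => h2 (by rw [← h, hσ x])
      have h4 : σ x ≠ σ y := fun h => h1 (hσ.injective h)
      simp [p', h1, h2, h3, h4, hp x hx]
  · have : homog p' y = (a, 1) := by simp [homog, p']
    rw [this]
    convert ha using 3
    exact Set.image_congr fun i hi => by rw [homog, homog, hp'Q i (by exact_mod_cast hi)]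

lemma exists_affIndepOn_union (hσ : Function.Involutive σ) (hγ : ∀ x, γ *ᵥ (γ *ᵥ x) = x)
    {Q R : Finset α} (hQ : ∃ p ∈ symConfigs γ σ, AffIndepOn p Q) (hQR : Disjoint Q R)
    (hR : ∀ y ∈ R, σ y = y ∨ (σ y ∉ Q ∧ σ y ∉ R)) (hcard : Q.card + R.card ≤ d + 1) :
    ∃ p ∈ symConfigs γ σ, AffIndepOn p (Q ∪ R) := by
  induction R using Finset.induction_on with
  | empty => simpa using hQ
  | insert y R hy ih =>
    rw [Finset.card_insert_of_notMem hy] at hcard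
    obtain ⟨p, hp, hind⟩ := ih (hQR.mono_right (Finset.subset_insert _ _))
      (fun z hz => (hR z (Finset.mem_insert_of_mem hz)).imp_right fun h =>
        ⟨h.1, fun h' => h.2 (Finset.mem_insert_of_mem h')⟩) (by omega)
    rw [Finset.union_insert]
    refine exists_insert_affIndepOn hσ hγ hp hind ?_ ?_ ?_
    · rw [Finset.mem_union, not_or]
      exact ⟨Finset.disjoint_right.1 hQR (Finset.mem_insert_self _ _), hy⟩
    · refine (hR y (Finset.mem_insert_self _ _)).imp_right fun h => ?_
      rw [Finset.mem_union, not_or]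
      exact ⟨h.1, fun h' => h.2 (Finset.mem_insert_of_mem h')⟩
    · have := Finset.card_union_le Q R
      omega

/-- The pair, if present, goes to distinct points a and γ a; the other points have no partner in `Q`
and are added one at a time. Two pairs could fail: for γ = -1 the points a, -a, b, -b are affinely
dependent. -/
lemma exists_affIndepOn (hσ : Function.Involutive σ) (hγ : ∀ x, γ *ᵥ (γ *ᵥ x) = x)
    (hne : ∃ a, γ *ᵥ a ≠ a) {Q : Finset α} (hQ : AtMostOnePair σ Q) (hcard : Q.card ≤ d + 1) :
    ∃ p ∈ symConfigs γ σ, AffIndepOn p Q := by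
  obtain ⟨x, hx⟩ := hQ
  by_cases hpair : x ∈ Q ∧ σ x ∈ Q ∧ σ x ≠ x
  · obtain ⟨hxQ, hσxQ, hσx⟩ := hpair
    have hsub : ({σ x, x} : Finset α) ⊆ Q := by
      intro z hz
      rcases Finset.mem_insert.1 hz with rfl | hz
      · exact hσxQ
      · rw [Finset.mem_singleton.1 hz]; exact hxQ
    have hbase : ∃ p ∈ symConfigs γ σ, AffIndepOn p ({σ x, x} : Finset α) := by
      obtain ⟨a, ha⟩ := hne
      let p : α → Fin d → ℝ := fun z => if z = x then a else if z = σ x then γ *ᵥ a else 0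
      have hpx : p x = a := by simp [p]
      have hpσx : p (σ x) = γ *ᵥ a := by simp [p, hσx]
      refine ⟨p, fun z hz => ?_, (affIndepOn_insert (by simpa using hσx)).2 ⟨?_, ?_⟩⟩
      · by_cases h1 : z = x
        · subst h1; rw [hpx, hpσx]
        by_cases h2 : z = σ x
        · subst h2; rw [hσ x, hpx, hpσx, hγ]
        · have h3 : σ z ≠ x := fun h => h2 (by rw [← h, hσ z])
          have h4 : σ z ≠ σ x := fun h => h1 (hσ.injective h)
          simp [p, h1, h2, h3, h4]
      · unfold AffIndepOn
        rw [Finset.coe_singleton, linearIndepOn_singleton_iff]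
        simp [homog]
      · rw [Finset.coe_singleton, Set.image_singleton, Submodule.mem_span_singleton]
        rintro ⟨c, hc⟩
        simp only [homog, hpx, hpσx, Prod.smul_mk, Prod.mk.injEq, smul_eq_mul, mul_one] at hc
        obtain ⟨hc, rfl⟩ := hc
        exact ha (by rw [← hc, one_smul])
    have := exists_affIndepOn_union hσ hγ (R := Q \ {σ x, x}) hbase Finset.disjoint_sdiff ?_ ?_
    · rwa [Finset.union_sdiff_of_subset hsub] at this
    · intro y hy
      rw [Finset.mem_sdiff] at hy
      by_contra! hcon
      have hσy : σ y ∈ Q := by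
        by_cases h : σ y ∈ ({σ x, x} : Finset α)
        · exact hsub h
        · exact (Finset.mem_sdiff.1 (hcon.2 h)).1
      rcases hx y hy.1 hσy hcon.1 with rfl | h
      · exact hy.2 (by simp)
      · exact hy.2 (by rw [← h, hσ y]; simp)
    · rw [← Finset.card_union_of_disjoint Finset.disjoint_sdiff,
        Finset.union_sdiff_of_subset hsub]
      exact hcard
  · have := exists_affIndepOn_union hσ hγ (Q := ∅) (R := Q)
      ⟨0, zero_mem _, by simp [AffIndepOn]⟩ (Finset.disjoint_empty_left _) ?_ (by simpa using hcard)
    · simpa using this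
    · intro y hy
      by_contra! hcon
      have hσy : σ y ∈ Q := hcon.2 (by simp)
      rcases hx y hy hσy hcon.1 with rfl | h
      · exact hpair ⟨hy, hσy, hcon.1⟩
      · refine hpair ⟨h ▸ hσy, ?_, ?_⟩
        · rw [← h, hσ y]; exact hy
        · rw [← h, hσ y]; exact hcon.1.symm

/-- Partners are non-adjacent, so a clique contains no pair and the only possible pair involves `w`.
Every general-position requirement below is met by a clique or a clique plus one vertex. -/
lemma AtMostOnePair.of_insert_isClique {G : SimpleGraph α} {w : α}
    {Q : Finset α} (hQ : G.IsClique Q) (hG : ∀ x, ¬ G.Adj x (σ x)) :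
    AtMostOnePair σ (insert w Q) := by
  refine ⟨w, fun y hy hσy hne => ?_⟩
  rcases Finset.mem_insert.1 hy with rfl | hy
  · exact Or.inl rfl
  rcases Finset.mem_insert.1 hσy with h | hσy
  · exact Or.inr h
  · exact absurd (hQ hy hσy hne.symm) (hG y)

lemma symRigid_clique (hσ : Function.Involutive σ) (hγ : ∀ x, γ *ᵥ (γ *ᵥ x) = x)
    (hne : ∃ a, γ *ᵥ a ≠ a) {G : SimpleGraph α} {U : Finset α} (hcard : U.card = d)
    (hclique : G.IsClique U) (hpair : AtMostOnePair σ U) : SymRigid γ σ G U := by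
  obtain ⟨p, hp, hind⟩ := exists_affIndepOn hσ hγ hne hpair (by omega)
  exact ⟨p, hp, rigidOn_clique hcard hclique hind⟩

lemma SymRigid.union (hσ : Function.Involutive σ) (hγ : ∀ x, γ *ᵥ (γ *ᵥ x) = x)
    (hne : ∃ a, γ *ᵥ a ≠ a) {G : SimpleGraph α} {W₁ W₂ U : Finset α} (h₁ : SymRigid γ σ G W₁)
    (h₂ : SymRigid γ σ G W₂) (hU₁ : U ⊆ W₁) (hU₂ : U ⊆ W₂) (hcard : U.card = d)
    (hpair : AtMostOnePair σ U) : SymRigid γ σ G (W₁ ∪ W₂) := by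
  obtain ⟨p, hp, ⟨hr₁, hr₂⟩, hind⟩ := IsLineOpen.exists_and
    ((RigidOn.isLineOpen G W₁).and (RigidOn.isLineOpen G W₂)) (AffIndepOn.isLineOpen U)
    (IsLineOpen.exists_and (RigidOn.isLineOpen G W₁) (RigidOn.isLineOpen G W₂) h₁ h₂)
    (exists_affIndepOn hσ hγ hne hpair (by omega))
  exact ⟨p, hp, hr₁.union hr₂ hU₁ hU₂ hcard hind⟩

lemma SymRigid.insert_vertex (hσ : Function.Involutive σ) (hγ : ∀ x, γ *ᵥ (γ *ᵥ x) = x)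
    (hne : ∃ a, γ *ᵥ a ≠ a) {G : SimpleGraph α} {W N : Finset α} {w : α} (h : SymRigid γ σ G W)
    (hN : N ⊆ W) (hcard : N.card = d) (hadj : ∀ n ∈ N, G.Adj n w)
    (hpair : AtMostOnePair σ (insert w N)) : SymRigid γ σ G (insert w W) := by
  have hc : (insert w N).card ≤ d + 1 := by
    have := Finset.card_insert_le w N
    omega
  obtain ⟨p, hp, hr, hind⟩ := IsLineOpen.exists_and (RigidOn.isLineOpen G W)
    (AffIndepOn.isLineOpen (insert w N)) h (exists_affIndepOn hσ hγ hne hpair hc)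
  exact ⟨p, hp, hr.insert_vertex hN hcard hadj hind⟩

/-- The new vertex is fixed by `σ`, so its position is unconstrained and may be chosen as the split
dictates. -/
lemma SymRigid.split (hσ : Function.Involutive σ) (hγ : ∀ x, γ *ᵥ (γ *ᵥ x) = x)
    (hne : ∃ a, γ *ᵥ a ≠ a) {G H : SimpleGraph α} {W C U : Finset α} {u v : α}
    (h : SymRigid γ σ H W) (hv : v ∉ W) (hσv : σ v = v) (hu : u ∈ W) (huv : G.Adj u v)
    (hH : ∀ a ∈ W, ∀ b ∈ W, H.Adj a b →
      G.Adj a b ∨ (a = u ∧ G.Adj v b) ∨ (b = u ∧ G.Adj a v))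
    (hC : C ⊆ W) (hCadj : ∀ c ∈ C, G.Adj c u ∧ G.Adj c v) (hCcard : C.card + 1 = d)
    (hCpair : AtMostOnePair σ (insert u C)) (hU : U ⊆ W) (hUcard : U.card = d)
    (hUclique : G.IsClique U) (hUpair : AtMostOnePair σ U) : SymRigid γ σ G (insert v W) := by
  have hc : (insert u C).card ≤ d + 1 := by
    have := Finset.card_insert_le u C
    omega
  obtain ⟨p, hp, ⟨hr, hindC⟩, hindU⟩ := IsLineOpen.exists_and
    ((RigidOn.isLineOpen H W).and (AffIndepOn.isLineOpen (insert u C))) (AffIndepOn.isLineOpen U)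
    (IsLineOpen.exists_and (RigidOn.isLineOpen H W) (AffIndepOn.isLineOpen (insert u C)) h
      (exists_affIndepOn hσ hγ hne hCpair hc))
    (exists_affIndepOn hσ hγ hne hUpair (by omega))
  obtain ⟨a, ha⟩ := hr.split hv hu huv hH hC hCadj hCcard hindC hU hUcard hUclique hindU
  refine ⟨_, fun x hx => ?_, ha⟩
  have h1 : x ≠ v := by rintro rfl; exact hx hσv
  have h2 : σ x ≠ v := fun h => h1 (by rw [← hσ x, h, hσv])
  rw [Function.update_of_ne h1, Function.update_of_ne h2, hp x hx]

lemma restrictInvolution_involutive (hσ : Function.Involutive σ) (W : Finset α) :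
    Function.Involutive (restrictInvolution σ W) := by
  intro x
  by_cases h : x ∈ W ∧ σ x ∈ W
  · have h2 : restrictInvolution σ W x = σ x := if_pos h
    rw [h2, restrictInvolution, hσ x, if_pos ⟨h.2, h.1⟩]
  · have h2 : restrictInvolution σ W x = x := if_neg h
    rw [h2, h2]

/-- Vertices outside `W` do not affect rigidity on `W`, so a partner outside `W` can simply be
placed at the γ-image. -/
lemma SymRigid.of_restrictInvolution (hσ : Function.Involutive σ)
    (hγ : ∀ x, γ *ᵥ (γ *ᵥ x) = x) {G : SimpleGraph α} {W : Finset α}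
    (h : SymRigid γ (restrictInvolution σ W) G W) : SymRigid γ σ G W := by
  obtain ⟨p, hp, hr⟩ := h
  let p' : α → Fin d → ℝ := fun x => if x ∈ W then p x else if σ x ∈ W then γ *ᵥ p (σ x) else 0
  refine ⟨p', fun x hx => ?_, hr.congr fun i hi => by simp [p', hi]⟩
  by_cases h1 : x ∈ W <;> by_cases h2 : σ x ∈ W
  · have h3 : restrictInvolution σ W x = σ x := if_pos ⟨h1, h2⟩
    have := hp x (by rwa [h3])
    rw [h3] at this
    simp [p', h1, h2, this]
  · simp [p', h1, h2, hσ x]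
  · simp [p', h1, h2, hγ]
  · simp [p', h1, h2, hσ x]

end Symmetric

/-! ### Graphs, boundaries and cycles of finite sets of simplices; contraction of an edge. -/

section FaceGraph

variable {α : Type*}

/-- The graph on `α` whose edges are the pairs contained in members of `T`. -/
def faceGraph (T : Finset (Finset α)) : SimpleGraph α where
  Adj a b := a ≠ b ∧ ∃ U ∈ T, a ∈ U ∧ b ∈ U
  symm := ⟨fun _ _ h => ⟨h.1.symm, h.2.imp fun _ hU => ⟨hU.1, hU.2.2, hU.2.1⟩⟩⟩
  loopless := ⟨fun _ h => h.1 rfl⟩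

lemma isClique_faceGraph {T : Finset (Finset α)} {U : Finset α} (hU : U ∈ T) :
    (faceGraph T).IsClique U := fun _ ha _ hb hab => ⟨hab, U, hU, ha, hb⟩

lemma faceGraph_mono {R S : Finset (Finset α)} (h : R ⊆ S) {a b : α}
    (hab : (faceGraph R).Adj a b) : (faceGraph S).Adj a b :=
  ⟨hab.1, hab.2.imp fun _ hU => ⟨h hU.1, hU.2⟩⟩

end FaceGraph

section Chains

variable {α : Type*} [DecidableEq α] {k : ℕ} {u v : α}

/-- The number of members of `T` containing `G`. -/
def faceDegree (T : Finset (Finset α)) (G : Finset α) : ℕ := (T.filter (G ⊆ ·)).card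

/-- The vertices of `T`. -/
def verts (T : Finset (Finset α)) : Finset α := T.biUnion id

lemma mem_verts {T : Finset (Finset α)} {x : α} : x ∈ verts T ↔ ∃ U ∈ T, x ∈ U := by
  simp [verts]

lemma subset_verts {T : Finset (Finset α)} {U : Finset α} (hU : U ∈ T) : U ⊆ verts T :=
  fun _ hx => mem_verts.2 ⟨U, hU, hx⟩

lemma exists_of_faceDegree_pos {T : Finset (Finset α)} {G : Finset α} (h : 0 < faceDegree T G) :
    ∃ U ∈ T, G ⊆ U := by
  obtain ⟨U, hU⟩ := Finset.card_pos.1 h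
  exact ⟨U, (Finset.mem_filter.1 hU).1, (Finset.mem_filter.1 hU).2⟩

lemma exists_of_odd_faceDegree {T : Finset (Finset α)} {G : Finset α} (h : Odd (faceDegree T G)) :
    ∃ U ∈ T, G ⊆ U := exists_of_faceDegree_pos h.pos

lemma faceDegree_union {T T' : Finset (Finset α)} (h : Disjoint T T') (G : Finset α) :
    faceDegree (T ∪ T') G = faceDegree T G + faceDegree T' G := by
  rw [faceDegree, Finset.filter_union, Finset.card_union_of_disjoint
    (Finset.disjoint_filter_filter h)]
  rfl

lemma faceDegree_sdiff {T T' : Finset (Finset α)} (h : T' ⊆ T) (G : Finset α) :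
    faceDegree T G = faceDegree T' G + faceDegree (T \ T') G := by
  rw [← faceDegree_union Finset.disjoint_sdiff, Finset.union_sdiff_of_subset h]

/-- Double counting: a member containing `E` has exactly (k + 1) - (k - 1) = 2 vertices outside it.
-/
lemma sum_faceDegree_insert {T : Finset (Finset α)} (hT : ∀ U ∈ T, U.card = k + 1)
    {E : Finset α} (hE : E.card + 1 = k) :
    ∑ y ∈ verts T \ E, faceDegree T (insert y E) = 2 * faceDegree T E := by
  simp only [faceDegree, Finset.card_filter]
  rw [Finset.sum_comm, Finset.mul_sum]
  refine Finset.sum_congr rfl fun U hU => ?_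
  rw [← Finset.card_filter]
  by_cases h : E ⊆ U
  · rw [if_pos h]
    have : (verts T \ E).filter (fun y => insert y E ⊆ U) = U \ E := by
      ext y
      simp only [Finset.mem_filter, Finset.mem_sdiff, Finset.insert_subset_iff]
      exact ⟨fun hy => ⟨hy.2.1, hy.1.2⟩, fun hy => ⟨⟨subset_verts hU hy.1, hy.2⟩, hy.1, h⟩⟩
    rw [this, Finset.card_sdiff_of_subset h, hT U hU]
    omega
  · rw [if_neg h, mul_zero, Finset.card_eq_zero]
    exact Finset.filter_eq_empty_iff.2 fun (y : α) _ hy => h ((Finset.subset_insert y E).trans hy)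

/-- The boundary of a boundary vanishes. -/
lemma even_card_odd_faceDegree {T : Finset (Finset α)} (hT : ∀ U ∈ T, U.card = k + 1)
    {E : Finset α} (hE : E.card + 1 = k) :
    Even ((verts T \ E).filter fun y => Odd (faceDegree T (insert y E))).card := by
  have h := sum_faceDegree_insert hT hE
  rw [← Finset.even_sum_iff_even_card_odd, h]
  exact even_two_mul _

/-- Every ridge of the boundary of a multicomplex lies in a second boundary face. -/
lemma exists_other_odd {T : Finset (Finset α)} (hT : ∀ U ∈ T, U.card = k + 1)
    {G : Finset α} (hG : G.card = k) (hodd : Odd (faceDegree T G)) {w : α} (hw : w ∈ G) :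
    ∃ y ∉ G, Odd (faceDegree T (insert y (G.erase w))) := by
  have hE : (G.erase w).card + 1 = k := by rw [Finset.card_erase_add_one hw, hG]
  have h := even_card_odd_faceDegree hT hE
  obtain ⟨U, hU, hGU⟩ := exists_of_odd_faceDegree hodd
  have hwmem : w ∈ (verts T \ G.erase w).filter
      fun y => Odd (faceDegree T (insert y (G.erase w))) := by
    rw [Finset.mem_filter, Finset.insert_erase hw]
    exact ⟨Finset.mem_sdiff.2 ⟨subset_verts hU (hGU hw), by simp⟩, hodd⟩
  have hlt : 1 < ((verts T \ G.erase w).filter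
      fun y => Odd (faceDegree T (insert y (G.erase w)))).card := by
    have := Finset.card_pos.2 ⟨w, hwmem⟩
    obtain ⟨m, hm⟩ := h
    omega
  obtain ⟨y, hy, hyw⟩ := Finset.exists_mem_ne hlt w
  rw [Finset.mem_filter, Finset.mem_sdiff] at hy
  exact ⟨y, fun h => hy.1.2 (Finset.mem_erase.2 ⟨hyw, h⟩), hy.2⟩

/-- A finite set of `(k+1)`-sets with vanishing boundary. -/
def IsCycle (k : ℕ) (T : Finset (Finset α)) : Prop :=
  (∀ U ∈ T, U.card = k + 1) ∧ ∀ G : Finset α, G.card = k → Even (faceDegree T G)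

/-- A minimal non-empty cycle without repeated members. -/
def IsCircuit (k : ℕ) (T : Finset (Finset α)) : Prop :=
  T.Nonempty ∧ IsCycle k T ∧ ∀ T' ⊂ T, T'.Nonempty → ¬ IsCycle k T'

lemma isSimplicialCycle_iff {S : Multiset (Finset α)} :
    IsSimplicialCycle k S ↔ (∀ U ∈ S, U.card = k + 1) ∧
      ∀ G : Finset α, G.card = k → Even (S.countP (G ⊆ ·)) := by
  unfold IsSimplicialCycle IsMulticomplex
  refine and_congr_right fun _ => ?_
  rw [Set.eq_empty_iff_forall_notMem]
  refine forall_congr' fun G => ?_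
  constructor
  · intro h hG
    by_contra hodd
    rw [Nat.not_even_iff_odd] at hodd
    refine h ⟨?_, hG, ?_⟩
    · obtain ⟨U, hU, hGU⟩ := Multiset.countP_pos.1 hodd.pos
      exact fun x hx => ⟨U, hU, hGU hx⟩
    · convert hodd
  · rintro h ⟨-, hG, hodd⟩
    refine Nat.not_even_iff_odd.2 hodd ?_
    convert h hG

lemma isSimplicialCycle_val {T : Finset (Finset α)} : IsSimplicialCycle k T.val ↔ IsCycle k T := by
  rw [isSimplicialCycle_iff]
  simp only [Multiset.countP_eq_card_filter]
  rfl

/-- A repeated member U yields the sub-cycle {U, U}, which by minimality is everything. -/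
lemma IsSimplicialCircuit.cases {S : Multiset (Finset α)} (hS : IsSimplicialCircuit k S) :
    (∃ T, S = T.val ∧ IsCircuit k T) ∨ ∃ U : Finset α, U.card = k + 1 ∧ S = {U, U} := by
  by_cases hnd : S.Nodup
  · refine Or.inl ⟨⟨S, hnd⟩, rfl, ?_, isSimplicialCycle_val.1 hS.2.1, fun T' hT' hne hcyc => ?_⟩
    · exact Finset.nonempty_iff_ne_empty.2 fun h => hS.1 (congrArg Finset.val h)
    · exact hS.2.2 T'.val (Finset.val_lt_iff.2 hT') (by rw [Ne, Finset.val_eq_zero]; exact hne.ne_empty)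
        (isSimplicialCycle_val.2 hcyc)
  · obtain ⟨U, hU⟩ : ∃ U, ({U, U} : Multiset (Finset α)) ≤ S := by
      by_contra! h
      exact hnd (Multiset.nodup_iff_le.2 h)
    have hcard : U.card = k + 1 := hS.2.1.1 U (Multiset.mem_of_le hU (by simp))
    refine Or.inr ⟨U, hcard, ?_⟩
    by_contra hne
    refine hS.2.2 _ (lt_of_le_of_ne hU (Ne.symm hne)) (by simp) (isSimplicialCycle_iff.2 ⟨?_, ?_⟩)
    · intro U' hU'
      have : U' = U := by simpa using hU'
      rw [this, hcard]
    · intro G _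
      by_cases h : G ⊆ U <;> simp [Multiset.insert_eq_cons, ← Multiset.cons_zero, h]

/-- Every face of a cycle without repetitions lies in a second member. -/
lemma IsCycle.exists_swap {S : Finset (Finset α)} (hS : IsCycle k S) {U : Finset α} (hU : U ∈ S)
    {w : α} (hw : w ∈ U) : ∃ y ∉ U, insert y (U.erase w) ∈ S := by
  have hcard : (U.erase w).card = k := by rw [Finset.card_erase_of_mem hw, hS.1 U hU]; simp
  have heven := hS.2 _ hcard
  have hmem : U ∈ S.filter (U.erase w ⊆ ·) :=
    Finset.mem_filter.2 ⟨hU, Finset.erase_subset _ _⟩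
  have hlt : 1 < (S.filter (U.erase w ⊆ ·)).card := by
    have := Finset.card_pos.2 ⟨U, hmem⟩
    obtain ⟨m, hm⟩ := heven
    rw [faceDegree] at hm
    omega
  obtain ⟨U', hU', hne⟩ := Finset.exists_mem_ne hlt U
  rw [Finset.mem_filter] at hU'
  have hU'card := hS.1 U' hU'.1
  obtain ⟨y, hy, hyU'⟩ : ∃ y, y ∉ U.erase w ∧ insert y (U.erase w) = U' := by
    have h1 : (U' \ U.erase w).card = 1 := by
      rw [Finset.card_sdiff_of_subset hU'.2, hcard, hU'card]; simp
    obtain ⟨y, hy⟩ := Finset.card_eq_one.1 h1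
    refine ⟨y, fun h => ?_, ?_⟩
    · have : y ∈ U' \ U.erase w := by rw [hy]; simp
      exact (Finset.mem_sdiff.1 this).2 h
    · rw [Finset.insert_eq, ← hy, Finset.sdiff_union_of_subset hU'.2]
  refine ⟨y, fun h => ?_, hyU' ▸ hU'.1⟩
  have hyw : y = w := by
    by_contra hyw
    exact hy (Finset.mem_erase.2 ⟨hyw, h⟩)
  subst hyw
  rw [Finset.insert_erase hw] at hyU'
  exact hne hyU'.symm

/-- The image of a simplex under the contraction of `v` to `u`. -/
def contractSet (u v : α) (U : Finset α) : Finset α := U.image fun x => if x = v then u else x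

lemma mem_contractSet (huv : u ≠ v) {U : Finset α} {x : α} :
    x ∈ contractSet u v U ↔ (x ≠ v ∧ x ∈ U) ∨ (x = u ∧ v ∈ U) := by
  simp only [contractSet, Finset.mem_image]
  constructor
  · rintro ⟨y, hy, rfl⟩
    by_cases h : y = v
    · subst h; simp [hy]
    · simp [h, hy]
  · rintro (⟨h1, h2⟩ | ⟨rfl, h⟩)
    · exact ⟨x, h2, by simp [h1]⟩
    · exact ⟨v, h, by simp⟩

/-- The contraction of `v` to `u` maps `T` to a cycle. -/
def IsContractCycle (k : ℕ) (u v : α) (T : Finset (Finset α)) : Prop :=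
  (∀ G : Finset α, G.card = k → u ∉ G → v ∉ G → Even (faceDegree T G)) ∧
    ∀ F : Finset α, F.card + 1 = k → u ∉ F → v ∉ F →
      Even (faceDegree T (insert u F) + faceDegree T (insert v F))

/-- The members of `T` avoiding the edge `uv`. -/
def awayFrom (u v : α) (T : Finset (Finset α)) : Finset (Finset α) :=
  T.filter fun U => ¬ (u ∈ U ∧ v ∈ U)

lemma card_contractSet {U : Finset α} (hU : ¬ (u ∈ U ∧ v ∈ U)) :
    (contractSet u v U).card = U.card := by
  refine Finset.card_image_of_injOn fun x hx y hy hxy => ?_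
  have hx' : x ∈ U := hx
  have hy' : y ∈ U := hy
  split_ifs at hxy with h1 h2 h2
  · rw [h1, h2]
  · exact absurd ⟨hxy ▸ hy', h1 ▸ hx'⟩ hU
  · exact absurd ⟨hxy ▸ hx', h2 ▸ hy'⟩ hU
  · exact hxy

/-- No member contains both `u` and `v`, so sizes survive. Faces avoiding `u` and `v` keep their
degrees, while F + u in the image collects the members over F + u and over F + v. -/
lemma isSimplicialCycle_map_contractSet (huv : u ≠ v) {T : Finset (Finset α)}
    (hT : ∀ U ∈ T, U.card = k + 1) (hTuv : ∀ U ∈ T, ¬ (u ∈ U ∧ v ∈ U)) :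
    IsSimplicialCycle k (T.val.map (contractSet u v)) ↔ IsContractCycle k u v T := by
  have hcount : ∀ G : Finset α, (T.val.map (contractSet u v)).countP (G ⊆ ·) =
      (T.filter (fun U => G ⊆ contractSet u v U)).card := by
    intro G
    rw [Multiset.countP_map]
    rfl
  have h1 : ∀ G : Finset α, u ∉ G → v ∉ G →
      (T.val.map (contractSet u v)).countP (G ⊆ ·) = faceDegree T G := by
    intro G hu hv
    rw [hcount, faceDegree]
    congr 1
    refine Finset.filter_congr fun U _ => forall₂_congr fun x hx => ?_
    rw [mem_contractSet huv]
    have h1 : x ≠ u := fun h => hu (h ▸ hx)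
    have h2 : x ≠ v := fun h => hv (h ▸ hx)
    simp [h1, h2]
  have h2 : ∀ F : Finset α, u ∉ F → v ∉ F →
      (T.val.map (contractSet u v)).countP (insert u F ⊆ ·) =
        faceDegree T (insert u F) + faceDegree T (insert v F) := by
    intro F hu hv
    rw [hcount, faceDegree, faceDegree, ← Finset.card_union_of_disjoint, ← Finset.filter_or]
    · congr 1
      refine Finset.filter_congr fun U hU => ?_
      have hF : F ⊆ contractSet u v U ↔ F ⊆ U := by
        refine forall₂_congr fun x hx => ?_
        rw [mem_contractSet huv]
        have h1 : x ≠ u := fun h => hu (h ▸ hx)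
        have h2 : x ≠ v := fun h => hv (h ▸ hx)
        simp [h1, h2]
      rw [Finset.insert_subset_iff, Finset.insert_subset_iff, Finset.insert_subset_iff, hF,
        mem_contractSet huv]
      have := huv
      tauto
    · refine Finset.disjoint_filter.2 fun U hU h1 h2 => hTuv U hU ?_
      exact ⟨h1 (Finset.mem_insert_self _ _), h2 (Finset.mem_insert_self _ _)⟩
  rw [isSimplicialCycle_iff]
  constructor
  · rintro ⟨-, h⟩
    refine ⟨fun G hG hu hv => ?_, fun F hF hu hv => ?_⟩
    · rw [← h1 G hu hv]; exact h G hG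
    · rw [← h2 F hu hv]
      exact h _ (by rw [Finset.card_insert_of_notMem hu, hF])
  · rintro ⟨hG1, hF1⟩
    refine ⟨fun U hU => ?_, fun G hG => ?_⟩
    · obtain ⟨U', hU', rfl⟩ := Multiset.mem_map.1 hU
      rw [card_contractSet (hTuv U' hU'), hT U' hU']
    · by_cases hv : v ∈ G
      · rw [hcount, Finset.card_eq_zero.2]
        · exact Even.zero
        · refine Finset.filter_eq_empty_iff.2 fun U _ h => ?_
          have := (mem_contractSet huv).1 (h hv)
          simp [huv.symm] at this
      by_cases hu : u ∈ G
      · have hF : (G.erase u).card + 1 = k := by rw [Finset.card_erase_add_one hu, hG]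
        have hvF : v ∉ G.erase u := fun h => hv (Finset.mem_of_mem_erase h)
        have := hF1 (G.erase u) hF (by simp) hvF
        rwa [← h2 _ (by simp) hvF, Finset.insert_erase hu] at this
      · rw [h1 G hu hv]
        exact hG1 G hG hu hv

lemma IsContractCycle.sdiff {T T' : Finset (Finset α)} (hT : IsContractCycle k u v T)
    (hT' : IsContractCycle k u v T') (h : T' ⊆ T) : IsContractCycle k u v (T \ T') := by
  refine ⟨fun G hG hu hv => ?_, fun F hF hu hv => ?_⟩
  · have h1 := hT.1 G hG hu hv
    rw [faceDegree_sdiff h] at h1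
    exact (Nat.even_add.1 h1).1 (hT'.1 G hG hu hv)
  · have h1 := hT.2 F hF hu hv
    rw [faceDegree_sdiff h, faceDegree_sdiff h, add_add_add_comm] at h1
    exact (Nat.even_add.1 h1).1 (hT'.2 F hF hu hv)

lemma IsContractCycle.union {T T' : Finset (Finset α)} (hT : IsContractCycle k u v T)
    (hT' : IsContractCycle k u v T') (h : Disjoint T T') : IsContractCycle k u v (T ∪ T') := by
  refine ⟨fun G hG hu hv => ?_, fun F hF hu hv => ?_⟩
  · rw [faceDegree_union h]
    exact (hT.1 G hG hu hv).add (hT'.1 G hG hu hv)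
  · rw [faceDegree_union h, faceDegree_union h, add_add_add_comm]
    exact (hT.2 F hF hu hv).add (hT'.2 F hF hu hv)

lemma exists_le_map_eq {β δ : Type*} {f : β → δ} {s : Multiset β} {t : Multiset δ}
    (h : t ≤ s.map f) : ∃ s' ≤ s, s'.map f = t := by
  induction s using Quotient.inductionOn with | _ l =>
  induction t using Quotient.inductionOn with | _ m =>
  obtain ⟨m', hperm, hsub⟩ := h
  obtain ⟨l', hl', rfl⟩ := List.sublist_map_iff.1 hsub
  exact ⟨l', hl'.subperm, Quotient.sound hperm⟩

/-- Each sub-multiset of the image is the image of a subset of `T`, so minimality can be tested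
before contracting. -/
lemma isSimplicialCircuit_map_contractSet (huv : u ≠ v) {T : Finset (Finset α)}
    (hT : ∀ U ∈ T, U.card = k + 1) (hTuv : ∀ U ∈ T, ¬ (u ∈ U ∧ v ∈ U)) (hne : T.Nonempty)
    (hcyc : IsContractCycle k u v T)
    (hmin : ∀ T' ⊂ T, T'.Nonempty → ¬ IsContractCycle k u v T') :
    IsSimplicialCircuit k (T.val.map (contractSet u v)) := by
  refine ⟨?_, (isSimplicialCycle_map_contractSet huv hT hTuv).2 hcyc, fun Q hQ hQ0 hQcyc => ?_⟩
  · rw [Ne, Multiset.map_eq_zero, Finset.val_eq_zero]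
    exact hne.ne_empty
  · obtain ⟨Q', hQ', rfl⟩ : ∃ Q' ≤ T.val, Q'.map (contractSet u v) = Q :=
      exists_le_map_eq hQ.le
    have hnd : Q'.Nodup := Multiset.nodup_of_le hQ' T.nodup
    have hsub : (⟨Q', hnd⟩ : Finset (Finset α)) ⊆ T := Finset.val_le_iff.1 hQ'
    refine hmin ⟨Q', hnd⟩ ⟨hsub, fun h => ?_⟩ ?_ ?_
    · have : (⟨Q', hnd⟩ : Finset (Finset α)) = T := Finset.Subset.antisymm hsub h
      rw [← this] at hQ
      exact lt_irrefl _ hQ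
    · refine Finset.nonempty_iff_ne_empty.2 fun h => hQ0 ?_
      have : Q' = 0 := congrArg Finset.val h
      rw [this, Multiset.map_zero]
    · rw [← isSimplicialCycle_map_contractSet huv (fun U hU => hT U (hsub hU))
        fun U hU => hTuv U (hsub hU)]
      exact hQcyc

/-- The members of a cycle away from an edge contract to a cycle. -/
lemma isContractCycle_awayFrom (huv : u ≠ v) {S : Finset (Finset α)} (hS : IsCycle k S) :
    IsContractCycle k u v (awayFrom u v S) := by
  -- The discarded members contain `u` and `v`. By size they contain no k-set avoiding both, and
  -- they contribute equally to F + u and F + v, so the parities required are unaffected.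
  have hdeg : ∀ G, faceDegree S G = faceDegree (awayFrom u v S) G +
      (S.filter fun U => G ⊆ U ∧ u ∈ U ∧ v ∈ U).card := by
    intro G
    rw [faceDegree_sdiff (Finset.filter_subset (fun U => ¬ (u ∈ U ∧ v ∈ U)) S), awayFrom]
    congr 1
    rw [faceDegree]
    congr 1
    ext U
    simp only [Finset.mem_filter, Finset.mem_sdiff]
    tauto
  refine ⟨fun G hG hu hv => ?_, fun F hF hu hv => ?_⟩
  · have h := hS.2 G hG
    rwa [hdeg, Finset.card_eq_zero.2, add_zero] at h
    refine Finset.filter_eq_empty_iff.2 fun U hU ⟨h1, h2, h3⟩ => ?_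
    have hsub : insert u (insert v G) ⊆ U := by
      simp only [Finset.insert_subset_iff]; exact ⟨h2, h3, h1⟩
    have := Finset.card_le_card hsub
    rw [Finset.card_insert_of_notMem (by simp [huv, hu]), Finset.card_insert_of_notMem hv, hG,
      hS.1 U hU] at this
    omega
  · have h1 := hS.2 (insert u F) (by rw [Finset.card_insert_of_notMem hu, hF])
    have h2 := hS.2 (insert v F) (by rw [Finset.card_insert_of_notMem hv, hF])
    rw [hdeg] at h1 h2
    have h3 : (S.filter fun U => insert u F ⊆ U ∧ u ∈ U ∧ v ∈ U) =
        S.filter fun U => insert v F ⊆ U ∧ u ∈ U ∧ v ∈ U := by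
      refine Finset.filter_congr fun U _ => ?_
      rw [Finset.insert_subset_iff, Finset.insert_subset_iff]
      tauto
    rw [h3] at h1
    have h := h1.add h2
    rw [add_add_add_comm] at h
    exact (Nat.even_add.1 h).2 (Even.add_self _)

end Chains

/-! ### Fogelsanger's decomposition along a contracted edge. -/

section Contraction

variable {α : Type*} [DecidableEq α] {k : ℕ} {u v : α} {γ : Matrix (Fin (k + 1)) (Fin (k + 1)) ℝ}
  {σ : α → α}

lemma mem_awayFrom {T : Finset (Finset α)} {U : Finset α} :
    U ∈ awayFrom u v T ↔ U ∈ T ∧ ¬ (u ∈ U ∧ v ∈ U) := Finset.mem_filter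

lemma odd_iff_of_isContractCycle {T : Finset (Finset α)} (hT : IsContractCycle k u v T)
    {F : Finset α} (hF : F.card + 1 = k) (hu : u ∉ F) (hv : v ∉ F) :
    Odd (faceDegree T (insert u F)) ↔ Odd (faceDegree T (insert v F)) := by
  have := Nat.even_add.1 (hT.2 F hF hu hv)
  rw [← Nat.not_even_iff_odd, ← Nat.not_even_iff_odd, this]

lemma eq_insert_of_subset {G U : Finset α} {x : α} (hGU : G ⊆ U) (hx : x ∈ U) (hxG : x ∉ G)
    (hcard : U.card = G.card + 1) : U = insert x G :=
  (Finset.eq_of_subset_of_card_le (Finset.insert_subset hx hGU)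
    (by rw [Finset.card_insert_of_notMem hxG, hcard])).symm

/-- If all boundary faces `F + u` of `T` are filled by members `F + u + v` of `S`, then filling
them completes `T` to a cycle. -/
lemma isCycle_union_fill (huv : u ≠ v) {S T : Finset (Finset α)} (hS : IsCycle k S)
    (hT : T ⊆ awayFrom u v S) (hcyc : IsContractCycle k u v T)
    (hfill : ∀ F : Finset α, F.card + 1 = k → u ∉ F → v ∉ F → Odd (faceDegree T (insert u F)) →
      insert u (insert v F) ∈ S) :
    IsCycle k (T ∪ S.filter fun U => u ∈ U ∧ v ∈ U ∧ Odd (faceDegree T (U.erase v))) := by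
  set D := S.filter fun U => u ∈ U ∧ v ∈ U ∧ Odd (faceDegree T (U.erase v)) with hD
  have hmemD : ∀ U, U ∈ D ↔ U ∈ S ∧ u ∈ U ∧ v ∈ U ∧ Odd (faceDegree T (U.erase v)) := fun U =>
    Finset.mem_filter
  have hTS : T ⊆ S := hT.trans (Finset.filter_subset _ _)
  have hTcard : ∀ U ∈ T, U.card = k + 1 := fun U hU => hS.1 U (hTS hU)
  have hdisj : Disjoint T D := Finset.disjoint_left.2 fun U hU hUD =>
    (mem_awayFrom.1 (hT hU)).2 ⟨((hmemD U).1 hUD).2.1, ((hmemD U).1 hUD).2.2.1⟩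
  refine ⟨fun U hU => ?_, fun G hG => ?_⟩
  · rcases Finset.mem_union.1 hU with hU | hU
    exacts [hTcard U hU, hS.1 U ((hmemD U).1 hU).1]
  rw [faceDegree_union hdisj]
  have hone : ∀ F : Finset α, F.card + 1 = k → u ∉ F → v ∉ F →
      (G = insert u F ∨ G = insert v F) →
      faceDegree D G = if Odd (faceDegree T (insert u F)) then 1 else 0 := by
    intro F hF hu hv hGF
    have herase : (insert u (insert v F)).erase v = insert u F := by
      rw [Finset.insert_comm, Finset.erase_insert]
      simp [huv.symm, hv]
    have huni : ∀ U ∈ D, G ⊆ U → U = insert u (insert v F) := by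
      intro U hU hGU
      rw [hmemD] at hU
      refine (Finset.eq_of_subset_of_card_le ?_ ?_).symm
      · have hFU : F ⊆ U := by
          rcases hGF with rfl | rfl <;> exact (Finset.subset_insert _ _).trans hGU
        exact Finset.insert_subset hU.2.1 (Finset.insert_subset hU.2.2.1 hFU)
      · rw [Finset.card_insert_of_notMem (by simp [huv, hu]), Finset.card_insert_of_notMem hv,
          hS.1 U hU.1, hF]
    split_ifs with hodd
    · rw [faceDegree, Finset.card_eq_one]
      refine ⟨insert u (insert v F), Finset.eq_singleton_iff_unique_mem.2 ⟨?_, ?_⟩⟩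
      · rw [Finset.mem_filter, hmemD, herase]
        refine ⟨⟨hfill F hF hu hv hodd, by simp, by simp, hodd⟩, ?_⟩
        rcases hGF with rfl | rfl
        · exact Finset.insert_subset_insert _ (Finset.subset_insert _ _)
        · exact Finset.subset_insert _ _
      · exact fun U hU => huni U (Finset.mem_filter.1 hU).1 (Finset.mem_filter.1 hU).2
    · rw [faceDegree, Finset.card_eq_zero]
      refine Finset.filter_eq_empty_iff.2 fun U hU hGU => hodd ?_
      have := ((hmemD U).1 hU).2.2.2
      rwa [huni U hU hGU, herase] at this
  by_cases hu : u ∈ G <;> by_cases hv : v ∈ G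
  -- Fillers containing `G` correspond to boundary faces of `T` through the ridge G - v, and these
  -- are even in number because the boundary of a boundary vanishes.
  · have h0 : faceDegree T G = 0 := by
      rw [faceDegree, Finset.card_eq_zero]
      exact Finset.filter_eq_empty_iff.2 fun U hU hGU =>
        (mem_awayFrom.1 (hT hU)).2 ⟨hGU hu, hGU hv⟩
    rw [h0, zero_add]
    have hE : (G.erase v).card + 1 = k := by rw [Finset.card_erase_add_one hv, hG]
    have huE : u ∈ G.erase v := Finset.mem_erase.2 ⟨huv, hu⟩
    have heven := even_card_odd_faceDegree hTcard hE
    suffices h : ((verts T \ G.erase v).filter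
        fun y => Odd (faceDegree T (insert y (G.erase v)))).card = faceDegree D G by rwa [← h]
    have hyv : ∀ y, Odd (faceDegree T (insert y (G.erase v))) → y ≠ v := by
      rintro y hy rfl
      rw [Finset.insert_erase hv, h0] at hy
      exact absurd hy (by decide)
    refine Finset.card_bij (fun y _ => insert v (insert y (G.erase v))) ?_ ?_ ?_
    · intro y hy
      rw [Finset.mem_filter, Finset.mem_sdiff] at hy
      obtain ⟨⟨-, hyE⟩, hodd⟩ := hy
      have hne := hyv y hodd
      have hvn : v ∉ insert y (G.erase v) := by simp [hne.symm]
      rw [Finset.mem_filter, hmemD, Finset.erase_insert hvn]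
      have huy : u ∈ insert y (G.erase v) := Finset.mem_insert_of_mem huE
      refine ⟨⟨?_, Finset.mem_insert_of_mem huy, Finset.mem_insert_self _ _, hodd⟩, ?_⟩
      · have := hfill ((insert y (G.erase v)).erase u) ?_ (by simp)
          (fun h => hvn (Finset.mem_of_mem_erase h)) (by rwa [Finset.insert_erase huy])
        · rwa [Finset.insert_comm, Finset.insert_erase huy] at this
        · rw [Finset.card_erase_add_one huy, Finset.card_insert_of_notMem hyE, hE]
      · intro x hx
        by_cases hxv : x = v
        · simp [hxv]
        · simp [hxv, hx]
    · intro y hy z hz hyz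
      rw [Finset.mem_filter, Finset.mem_sdiff] at hy hz
      have h1 : y ∈ insert v (insert z (G.erase v)) := hyz ▸ by simp
      have h2 := hyv y hy.2
      have h3 := hy.1.2
      rw [Finset.mem_insert, Finset.mem_insert] at h1
      tauto
    · intro U hU
      rw [Finset.mem_filter, hmemD] at hU
      obtain ⟨⟨hUS, huU, hvU, hodd⟩, hGU⟩ := hU
      obtain ⟨y, hyU, hyG⟩ := Finset.exists_mem_notMem_of_card_lt_card
        (s := G) (t := U) (by rw [hG, hS.1 U hUS]; omega)
      have hU : U = insert y G := eq_insert_of_subset hGU hyU hyG (by rw [hG, hS.1 U hUS])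
      have hyv' : y ≠ v := fun h => hyG (h ▸ hv)
      have hUe : U.erase v = insert y (G.erase v) := by
        rw [hU, Finset.erase_insert_of_ne hyv']
      rw [hUe] at hodd
      obtain ⟨U', hU', hsub⟩ := exists_of_odd_faceDegree hodd
      refine ⟨y, ?_, ?_⟩
      · rw [Finset.mem_filter, Finset.mem_sdiff]
        exact ⟨⟨subset_verts hU' (hsub (by simp)), fun h => hyG (Finset.mem_of_mem_erase h)⟩, hodd⟩
      · rw [← hUe, Finset.insert_erase hvU]
  · have hF : (G.erase u).card + 1 = k := by rw [Finset.card_erase_add_one hu, hG]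
    have hvF : v ∉ G.erase u := fun h => hv (Finset.mem_of_mem_erase h)
    rw [hone (G.erase u) hF (by simp) hvF (Or.inl (Finset.insert_erase hu).symm),
      Finset.insert_erase hu]
    split_ifs with hodd
    · exact hodd.add_one
    · exact Nat.not_odd_iff_even.1 hodd
  · have hF : (G.erase v).card + 1 = k := by rw [Finset.card_erase_add_one hv, hG]
    have huF : u ∉ G.erase v := fun h => hu (Finset.mem_of_mem_erase h)
    rw [hone (G.erase v) hF huF (by simp) (Or.inr (Finset.insert_erase hv).symm)]
    simp only [odd_iff_of_isContractCycle hcyc hF huF (by simp : v ∉ G.erase v),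
      Finset.insert_erase hv]
    split_ifs with hodd
    · exact hodd.add_one
    · exact Nat.not_odd_iff_even.1 hodd
  · have h0 : faceDegree D G = 0 := by
      rw [faceDegree, Finset.card_eq_zero]
      refine Finset.filter_eq_empty_iff.2 fun U hU hGU => ?_
      rw [hmemD] at hU
      have hsub : insert u (insert v G) ⊆ U :=
        Finset.insert_subset hU.2.1 (Finset.insert_subset hU.2.2.1 hGU)
      have := Finset.card_le_card hsub
      rw [Finset.card_insert_of_notMem (by simp [huv, hu]), Finset.card_insert_of_notMem hv, hG,
        hS.1 U hU.1] at this
      omega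
    rw [h0, add_zero]
    exact hcyc.1 G hG hu hv

/-- The filled `T` is a non-empty cycle inside the circuit `S`, hence all of it. -/
lemma IsCircuit.mem_or_of_fill (huv : u ≠ v) {S T : Finset (Finset α)} (hS : IsCircuit k S)
    (hT : T ⊆ awayFrom u v S) (hne : T.Nonempty) (hcyc : IsContractCycle k u v T)
    (hfill : ∀ F : Finset α, F.card + 1 = k → u ∉ F → v ∉ F → Odd (faceDegree T (insert u F)) →
      insert u (insert v F) ∈ S) :
    ∀ U ∈ S, U ∈ T ∨ (u ∈ U ∧ v ∈ U ∧ Odd (faceDegree T (U.erase v))) := by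
  intro U hU
  by_contra hcon
  have hcycle := isCycle_union_fill huv hS.2.1 hT hcyc hfill
  refine hS.2.2 _ ⟨?_, fun h => hcon ?_⟩ (hne.mono Finset.subset_union_left) hcycle
  · exact Finset.union_subset (hT.trans (Finset.filter_subset _ _)) (Finset.filter_subset _ _)
  · rcases Finset.mem_union.1 (h hU) with h | h
    exacts [Or.inl h, Or.inr (Finset.mem_filter.1 h).2]

lemma mem_verts_image (huv : u ≠ v) {R : Finset (Finset α)} {x : α} :
    x ∈ verts (R.image (contractSet u v)) ↔
      (x ≠ v ∧ x ∈ verts R) ∨ (x = u ∧ v ∈ verts R) := by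
  simp only [mem_verts, Finset.exists_mem_image, mem_contractSet huv]
  constructor
  · rintro ⟨U, hU, ⟨h1, h2⟩ | ⟨h1, h2⟩⟩
    exacts [Or.inl ⟨h1, U, hU, h2⟩, Or.inr ⟨h1, U, hU, h2⟩]
  · rintro (⟨h1, U, hU, h2⟩ | ⟨h1, U, hU, h2⟩)
    exacts [⟨U, hU, Or.inl ⟨h1, h2⟩⟩, ⟨U, hU, Or.inr ⟨h1, h2⟩⟩]

lemma faceGraph_image_adj (huv : u ≠ v) {R : Finset (Finset α)} {a b : α}
    (h : (faceGraph (R.image (contractSet u v))).Adj a b) :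
    (faceGraph R).Adj a b ∨ (a = u ∧ (faceGraph R).Adj v b) ∨ (b = u ∧ (faceGraph R).Adj a v) := by
  obtain ⟨hab, U', hU', ha, hb⟩ := h
  obtain ⟨U, hU, rfl⟩ := Finset.mem_image.1 hU'
  rw [mem_contractSet huv] at ha hb
  rcases ha with ⟨hav, ha⟩ | ⟨rfl, ha⟩ <;> rcases hb with ⟨hbv, hb⟩ | ⟨hbu, hb⟩
  · exact Or.inl ⟨hab, U, hU, ha, hb⟩
  · exact Or.inr (Or.inr ⟨hbu, hav, U, hU, ha, hb⟩)
  · exact Or.inr (Or.inl ⟨rfl, hbv.symm, U, hU, ha, hb⟩)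
  · exact absurd hbu.symm hab

lemma verts_insert_image (huv : u ≠ v) {R : Finset (Finset α)} (hu : u ∈ verts R) :
    insert v (verts (R.image (contractSet u v))) = insert u (insert v (verts R)) := by
  ext x
  simp only [Finset.mem_insert, mem_verts_image huv]
  constructor
  · tauto
  · rintro (rfl | rfl | h)
    · exact Or.inr (Or.inl ⟨huv, hu⟩)
    · exact Or.inl rfl
    · by_cases hxv : x = v
      exacts [Or.inl hxv, Or.inr (Or.inl ⟨hxv, h⟩)]

/-- If the contraction of a piece of `S` is rigid, then so is the piece itself. -/
lemma symRigid_of_contraction (hk : 2 ≤ k) (hσ : Function.Involutive σ)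
    (hγ : ∀ x, γ *ᵥ (γ *ᵥ x) = x) (hne : ∃ a, γ *ᵥ a ≠ a) {S R : Finset (Finset α)}
    (hS : IsCycle k S) (huv : (faceGraph S).Adj u v) (hσv : σ v = v)
    (hG : ∀ x, ¬ (faceGraph S).Adj x (σ x)) (hR : R ⊆ awayFrom u v S)
    (hcyc : IsContractCycle k u v R) {F : Finset α} (hF : F.card + 1 = k) (huF : u ∉ F)
    (hvF : v ∉ F) (hodd : Odd (faceDegree R (insert u F)))
    (h : SymRigid γ σ (faceGraph (R.image (contractSet u v)))
      (verts (R.image (contractSet u v)))) :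
    SymRigid γ σ (faceGraph S) (insert u (insert v (verts R))) := by
  have huv' : u ≠ v := huv.1
  have hRS : R ⊆ S := hR.trans (Finset.filter_subset _ _)
  have hRcard : ∀ U ∈ R, U.card = k + 1 := fun U hU => hS.1 U (hRS hU)
  have hnbr : ∀ F' : Finset α, F'.card + 1 = k → u ∉ F' → v ∉ F' →
      Odd (faceDegree R (insert u F')) → ∀ c ∈ F', c ∈ verts (R.image (contractSet u v)) ∧
        (faceGraph S).Adj c u ∧ (faceGraph S).Adj c v := by
    intro F' hF' hu hv hodd c hc
    obtain ⟨U₁, hU₁, hsub₁⟩ := exists_of_odd_faceDegree hodd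
    obtain ⟨U₂, hU₂, hsub₂⟩ := exists_of_odd_faceDegree
      ((odd_iff_of_isContractCycle hcyc hF' hu hv).1 hodd)
    have hcu : c ≠ u := fun h => hu (h ▸ hc)
    have hcv : c ≠ v := fun h => hv (h ▸ hc)
    exact ⟨(mem_verts_image huv').2 (Or.inl ⟨hcv, mem_verts.2
        ⟨U₁, hU₁, hsub₁ (Finset.mem_insert_of_mem hc)⟩⟩),
      ⟨hcu, U₁, hRS hU₁, hsub₁ (Finset.mem_insert_of_mem hc), hsub₁ (Finset.mem_insert_self _ _)⟩,
      ⟨hcv, U₂, hRS hU₂, hsub₂ (Finset.mem_insert_of_mem hc), hsub₂ (Finset.mem_insert_self _ _)⟩⟩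
  obtain ⟨U₀, hU₀, hsub₀⟩ := exists_of_odd_faceDegree hodd
  have huU₀ : u ∈ U₀ := hsub₀ (Finset.mem_insert_self _ _)
  have hvU₀ : v ∉ U₀ := fun h => (mem_awayFrom.1 (hR hU₀)).2 ⟨huU₀, h⟩
  obtain ⟨w, hw⟩ : F.Nonempty := Finset.card_pos.1 (by omega)
  have huw : u ≠ w := fun h => huF (h ▸ hw)
  -- `F` gives only k - 1 common neighbours of `u` and `v`, one short of the d - 1 = k needed to
  -- split. The other boundary face at the ridge F - w + u supplies one more; k ≥ 2 ensures that w
  -- exists.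
  obtain ⟨y, hy, hyodd⟩ := exists_other_odd hRcard
    (by rw [Finset.card_insert_of_notMem huF, hF]) hodd (Finset.mem_insert_of_mem hw)
  rw [Finset.mem_insert, not_or] at hy
  rw [Finset.erase_insert_of_ne huw, Finset.insert_comm] at hyodd
  have hyv : y ≠ v := by
    rintro rfl
    obtain ⟨U, hU, hsub⟩ := exists_of_odd_faceDegree hyodd
    exact (mem_awayFrom.1 (hR hU)).2 ⟨hsub (by simp), hsub (by simp)⟩
  have hy' := hnbr (insert y (F.erase w))
    (by rw [Finset.card_insert_of_notMem fun h => hy.2 (Finset.mem_of_mem_erase h),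
      Finset.card_erase_add_one hw, hF])
    (by simp [Ne.symm hy.1, huF]) (by simp [hyv.symm, hvF]) hyodd y (Finset.mem_insert_self _ _)
  have hF' := hnbr F hF huF hvF hodd
  have huR : u ∈ verts R := subset_verts hU₀ huU₀
  rw [← verts_insert_image huv' huR]
  have hcliqueF : (faceGraph S).IsClique (insert u F : Finset α) :=
    (isClique_faceGraph (hRS hU₀)).subset (by exact_mod_cast hsub₀)
  have hC : ∀ c ∈ insert y F, c ∈ verts (R.image (contractSet u v)) ∧
      (faceGraph S).Adj c u ∧ (faceGraph S).Adj c v := by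
    intro c hc
    rcases Finset.mem_insert.1 hc with rfl | hc
    exacts [hy', hF' c hc]
  refine h.split hσ hγ hne (u := u) (C := insert y F) (U := U₀) ?_ hσv ?_ huv ?_
    (fun c hc => (hC c hc).1) (fun c hc => (hC c hc).2) ?_ ?_ ?_ (hRcard U₀ hU₀)
    (isClique_faceGraph (hRS hU₀)) ?_
  · rw [mem_verts_image huv']
    have := huv'
    tauto
  · exact (mem_verts_image huv').2 (Or.inl ⟨huv', huR⟩)
  · intro a _ b _ hab
    exact (faceGraph_image_adj huv' hab).imp (faceGraph_mono hRS)
      (Or.imp (And.imp_right (faceGraph_mono hRS)) (And.imp_right (faceGraph_mono hRS)))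
  · rw [Finset.card_insert_of_notMem hy.2, hF]
  · rw [Finset.insert_comm]
    exact AtMostOnePair.of_insert_isClique hcliqueF hG
  · exact fun x hx => (mem_verts_image huv').2
      (Or.inl ⟨fun h => hvU₀ (h ▸ hx), subset_verts hU₀ hx⟩)
  · have : Nonempty α := ⟨u⟩
    exact atMostOnePair_of_isClique (isClique_faceGraph (hRS hU₀)) hG

/-- Fogelsanger's decomposition: a circuit is rigid if the circuits obtained by contracting the
edge `uv` are rigid. -/
lemma symRigid_of_forall_contraction (hk : 2 ≤ k) (hσ : Function.Involutive σ)
    (hγ : ∀ x, γ *ᵥ (γ *ᵥ x) = x) (hne : ∃ a, γ *ᵥ a ≠ a) {S : Finset (Finset α)}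
    (hS : IsCircuit k S) (huv : (faceGraph S).Adj u v) (hσv : σ v = v)
    (hG : ∀ x, ¬ (faceGraph S).Adj x (σ x))
    (h : ∀ R ⊆ awayFrom u v S, IsSimplicialCircuit k (R.val.map (contractSet u v)) →
      SymRigid γ σ (faceGraph (R.image (contractSet u v)))
        (verts (R.image (contractSet u v)))) :
    SymRigid γ σ (faceGraph S) (verts S) := by
  classical
  have huv' : u ≠ v := huv.1
  obtain ⟨U₀, hU₀, huU₀, hvU₀⟩ := huv.2
  have hcardS := hS.2.1.1
  have hawayS : awayFrom u v S ⊆ S := Finset.filter_subset _ _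
  have hawaycyc := isContractCycle_awayFrom huv' hS.2.1
  have hswap : ∀ U ∈ S, u ∈ U → ∃ U' ∈ awayFrom u v S, U.erase u ⊆ U' := by
    intro U hU hu
    obtain ⟨y, hy, hyS⟩ := hS.2.1.exists_swap hU hu
    refine ⟨_, mem_awayFrom.2 ⟨hyS, fun h => ?_⟩, Finset.subset_insert _ _⟩
    rcases Finset.mem_insert.1 h.1 with rfl | h
    · exact hy hu
    · simp at h
  have hpiece : ∀ R ⊆ awayFrom u v S, R.Nonempty → IsContractCycle k u v R →
      (∀ T' ⊂ R, T'.Nonempty → ¬ IsContractCycle k u v T') →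
      ∀ F : Finset α, F.card + 1 = k → u ∉ F → v ∉ F → Odd (faceDegree R (insert u F)) →
      SymRigid γ σ (faceGraph S) (insert u (insert v (verts R))) := by
    intro R hR hRne hRcyc hmin F hF hu hv hodd
    refine symRigid_of_contraction hk hσ hγ hne hS.2.1 huv hσv hG hR hRcyc hF hu hv hodd
      (h R hR (isSimplicialCircuit_map_contractSet huv' (fun U hU => hcardS U (hawayS (hR hU)))
        (fun U hU => (mem_awayFrom.1 (hR hU)).2) hRne hRcyc hmin))
  let P : Finset (Finset α) → Prop := fun T => T.Nonempty ∧ IsContractCycle k u v T ∧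
    SymRigid γ σ (faceGraph S) (insert u (insert v (verts T)))
  have hinit : ((awayFrom u v S).powerset.filter P).Nonempty := by
    obtain ⟨U₁, hU₁, -⟩ := hswap U₀ hU₀ huU₀
    obtain ⟨R, hR, hmin⟩ := Finset.exists_min_image
      ((awayFrom u v S).powerset.filter fun T => T.Nonempty ∧ IsContractCycle k u v T) Finset.card
      ⟨awayFrom u v S, by
        rw [Finset.mem_filter, Finset.mem_powerset]; exact ⟨subset_rfl, ⟨U₁, hU₁⟩, hawaycyc⟩⟩
    rw [Finset.mem_filter, Finset.mem_powerset] at hR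
    obtain ⟨hR, hRne, hRcyc⟩ := hR
    -- Without such a boundary face `R` would already be a cycle, hence all of `S`, although it
    -- omits `U₀`.
    obtain ⟨F, hF, hu, hv, hodd⟩ : ∃ F : Finset α, F.card + 1 = k ∧ u ∉ F ∧ v ∉ F ∧
        Odd (faceDegree R (insert u F)) := by
      by_contra! hcon
      rcases hS.mem_or_of_fill huv' hR hRne hRcyc
        (fun F hF hu hv hodd => absurd hodd (hcon F hF hu hv))
        U₀ hU₀ with hmem | ⟨-, -, hodd⟩
      · exact (mem_awayFrom.1 (hR hmem)).2 ⟨huU₀, hvU₀⟩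
      · have huE : u ∈ U₀.erase v := Finset.mem_erase.2 ⟨huv', huU₀⟩
        have := hcon ((U₀.erase v).erase u) ?_ (by simp) (by simp)
        · rw [Finset.insert_erase huE] at this
          exact this hodd
        · rw [Finset.card_erase_add_one huE, Finset.card_erase_of_mem hvU₀, hcardS U₀ hU₀]
          simp
    refine ⟨R, ?_⟩
    rw [Finset.mem_filter, Finset.mem_powerset]
    refine ⟨hR, hRne, hRcyc, hpiece R hR hRne hRcyc (fun T' hT' hne' hcyc' => ?_) F hF hu hv hodd⟩
    have := hmin T' (by
      rw [Finset.mem_filter, Finset.mem_powerset]; exact ⟨hT'.1.trans hR, hne', hcyc'⟩)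
    exact absurd (Finset.card_lt_card hT') (not_lt.2 this)
  obtain ⟨T, hT, hmax⟩ := Finset.exists_max_image _ Finset.card hinit
  rw [Finset.mem_filter, Finset.mem_powerset] at hT
  obtain ⟨hT, hTne, hTcyc, hTrig⟩ := hT
  have hTall : T = awayFrom u v S := by
    by_contra hTa
    obtain ⟨U₁, hU₁, hU₁T⟩ := Finset.exists_of_ssubset
      (Finset.ssubset_iff_subset_ne.2 ⟨hT, hTa⟩)
    obtain ⟨F, hF, hu, hv, hodd, hmiss⟩ : ∃ F : Finset α, F.card + 1 = k ∧ u ∉ F ∧ v ∉ F ∧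
        Odd (faceDegree T (insert u F)) ∧ insert u (insert v F) ∉ S := by
      by_contra! hcon
      rcases hS.mem_or_of_fill huv' hT hTne hTcyc hcon U₁ (hawayS hU₁) with hmem | ⟨h1, h2, -⟩
      · exact hU₁T hmem
      · exact (mem_awayFrom.1 hU₁).2 ⟨h1, h2⟩
    -- As F + u + v is not in `S`, every member of `S` over F + u avoids the edge uv. Their number
    -- is even and `T` has an odd share.
    have hrest : Odd (faceDegree (awayFrom u v S \ T) (insert u F)) := by
      have h1 := hS.2.1.2 (insert u F) (by rw [Finset.card_insert_of_notMem hu, hF])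
      have h2 : faceDegree (S \ awayFrom u v S) (insert u F) = 0 := by
        rw [faceDegree, Finset.card_eq_zero]
        refine Finset.filter_eq_empty_iff.2 fun U hU hsub => hmiss ?_
        rw [Finset.mem_sdiff, mem_awayFrom] at hU
        have hvU : v ∈ U := by
          have := hU.1
          tauto
        rw [Finset.insert_comm, ← eq_insert_of_subset hsub hvU (by simp [huv'.symm, hv])]
        · exact hU.1
        · rw [hcardS U hU.1, Finset.card_insert_of_notMem hu, hF]
      rw [faceDegree_sdiff hawayS, h2, add_zero, faceDegree_sdiff hT] at h1
      rw [← Nat.not_even_iff_odd] at hodd ⊢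
      exact fun h => hodd ((Nat.even_add.1 h1).2 h)
    obtain ⟨R, hR, hmin⟩ := Finset.exists_min_image
      ((awayFrom u v S \ T).powerset.filter fun R => IsContractCycle k u v R ∧
        Odd (faceDegree R (insert u F))) Finset.card
      ⟨awayFrom u v S \ T, by
        rw [Finset.mem_filter, Finset.mem_powerset]
        exact ⟨subset_rfl, hawaycyc.sdiff hTcyc hT, hrest⟩⟩
    rw [Finset.mem_filter, Finset.mem_powerset] at hR
    obtain ⟨hR, hRcyc, hRodd⟩ := hR
    have hmin' : ∀ R' ⊂ R, IsContractCycle k u v R' → ¬ Odd (faceDegree R' (insert u F)) := by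
      intro R' hR' hcyc' hodd'
      have := hmin R' (by
        rw [Finset.mem_filter, Finset.mem_powerset]; exact ⟨hR'.1.trans hR, hcyc', hodd'⟩)
      exact absurd (Finset.card_lt_card hR') (not_lt.2 this)
    have hRaway : R ⊆ awayFrom u v S := hR.trans Finset.sdiff_subset
    obtain ⟨U₂, hU₂, hsub₂⟩ := exists_of_odd_faceDegree hRodd
    -- A smaller contract-cycle R' would split `R` into R' and its complement, one of which has odd
    -- degree at F + u, against the choice of `R`.
    have hRrig := hpiece R hRaway ⟨U₂, hU₂⟩ hRcyc (fun R' hR' hne' hcyc' => by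
      have h1 := hmin' R' hR' hcyc'
      refine hmin' (R \ R') (Finset.sdiff_ssubset hR'.1 hne') (hRcyc.sdiff hcyc' hR'.1) ?_
      rw [faceDegree_sdiff hR'.1] at hRodd
      exact (Nat.odd_add'.1 hRodd).2 (Nat.not_odd_iff_even.1 h1)) F hF hu hv hRodd
    obtain ⟨U₃, hU₃, hsub₃⟩ := exists_of_odd_faceDegree hodd
    obtain ⟨U₄, hU₄, hsub₄⟩ := exists_of_odd_faceDegree
      ((odd_iff_of_isContractCycle hTcyc hF hu hv).1 hodd)
    -- Although F + u + v is not a member, it is a clique: members of `T` contain F + u and F + v,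
    -- and uv is an edge. So it contains no pair.
    have hclique : (faceGraph S).IsClique (insert u (insert v F) : Finset α) := by
      have h3 := isClique_faceGraph (hawayS (hT hU₃))
      have h4 := isClique_faceGraph (hawayS (hT hU₄))
      rw [Finset.coe_insert]
      refine SimpleGraph.IsClique.insert (h4.subset (by exact_mod_cast hsub₄)) fun b hb _ => ?_
      rcases Finset.mem_insert.1 (Finset.mem_coe.1 hb) with rfl | hb
      · exact huv
      · exact h3 (hsub₃ (Finset.mem_insert_self _ _)) (hsub₃ (Finset.mem_insert_of_mem hb))
          (fun h => hu (h ▸ hb))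
    have : Nonempty α := ⟨u⟩
    have hsubW : ∀ {Q : Finset (Finset α)} {U : Finset α}, U ∈ Q → insert u F ⊆ U →
        insert u (insert v F) ⊆ insert u (insert v (verts Q)) := fun hU hsub =>
      Finset.insert_subset_insert _ (Finset.insert_subset_insert _
        (((Finset.subset_insert _ _).trans hsub).trans (subset_verts hU)))
    have hglue := hTrig.union hσ hγ hne hRrig (hsubW hU₃ hsub₃) (hsubW hU₂ hsub₂)
      (by rw [Finset.card_insert_of_notMem (by simp [huv', hu]), Finset.card_insert_of_notMem hv,
        hF]) (atMostOnePair_of_isClique hclique hG)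
    have hdisj : Disjoint T R := Finset.disjoint_of_subset_right hR Finset.disjoint_sdiff
    have hW : insert u (insert v (verts T)) ∪ insert u (insert v (verts R)) =
        insert u (insert v (verts (T ∪ R))) := by
      ext x
      simp only [verts, Finset.union_biUnion, Finset.mem_union, Finset.mem_insert]
      tauto
    rw [hW] at hglue
    have := hmax (T ∪ R) (by
      rw [Finset.mem_filter, Finset.mem_powerset]
      exact ⟨Finset.union_subset hT hRaway, hTne.mono Finset.subset_union_left,
        hTcyc.union hRcyc hdisj, hglue⟩)
    rw [Finset.card_union_of_disjoint hdisj] at this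
    have hRpos := Finset.card_pos.2 ⟨U₂, hU₂⟩
    omega
  subst hTall
  convert hTrig using 1
  ext x
  simp only [Finset.mem_insert]
  constructor
  · intro hx
    by_cases hxu : x = u
    · exact Or.inl hxu
    refine Or.inr (Or.inr ?_)
    obtain ⟨U, hU, hxU⟩ := mem_verts.1 hx
    by_cases hu : u ∈ U
    · obtain ⟨U', hU', hsub⟩ := hswap U hU hu
      exact subset_verts hU' (hsub (Finset.mem_erase.2 ⟨hxu, hxU⟩))
    · exact subset_verts (mem_awayFrom.2 ⟨hU, fun h => hu h.1⟩) hxU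
  · rintro (rfl | rfl | hx)
    · exact subset_verts hU₀ huU₀
    · exact subset_verts hU₀ hvU₀
    · obtain ⟨U, hU, hxU⟩ := mem_verts.1 hx
      exact subset_verts (hawayS hU) hxU

end Contraction

/-! ### From vertex pairings to involutions. -/

section Pairing

variable {α : Type*}

open Classical in
/-- The involution of `α` induced by a pairing of some of the vertices. -/
noncomputable def VertexPairing.involution {s : Set α} (P : VertexPairing s) (x : α) : α :=
  if h : ∃ hx : x ∈ s, (⟨x, hx⟩ : s) ∈ P.X then ((P.star ⟨⟨x, h.1⟩, h.2⟩ : s) : α) else x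

lemma VertexPairing.involution_coe {s : Set α} (P : VertexPairing s) (x : P.X) :
    P.involution ((x : s) : α) = (P.star x : s) :=
  dif_pos ⟨(x : s).2, x.2⟩

lemma VertexPairing.exists_of_involution_ne {s : Set α} (P : VertexPairing s) {x : α}
    (hx : P.involution x ≠ x) : ∃ y : P.X, ((y : s) : α) = x := by
  by_contra hcon
  exact hx (dif_neg fun ⟨h1, h2⟩ => hcon ⟨⟨⟨x, h1⟩, h2⟩, rfl⟩)

lemma VertexPairing.involution_involutive {s : Set α} (P : VertexPairing s) :
    Function.Involutive P.involution := by
  intro x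
  by_cases hx : P.involution x = x
  · rw [hx, hx]
  · obtain ⟨y, rfl⟩ := P.exists_of_involution_ne hx
    rw [P.involution_coe, P.involution_coe, P.star_star]

end Pairing

/-! ### The terminal case and the induction. -/

section Main

variable {α : Type*} [DecidableEq α] {k : ℕ} {γ : Matrix (Fin (k + 1)) (Fin (k + 1)) ℝ}
  {σ : α → α}

/-- The circuits in which no edge can be contracted compatibly with `σ` are rigid. -/
lemma symRigid_of_no_contraction (hk : 2 ≤ k) (hσ : Function.Involutive σ)
    (hγ : ∀ x, γ *ᵥ (γ *ᵥ x) = x) (hne : ∃ a, γ *ᵥ a ≠ a) {S : Finset (Finset α)}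
    (hS : IsCycle k S) (hSne : S.Nonempty) (hG : ∀ x, ¬ (faceGraph S).Adj x (σ x))
    (hsupp : ∀ x, σ x ≠ x → x ∈ verts S)
    (hcard : ((verts S).filter fun x => σ x ≠ x).card ≤ 2 * k)
    (hstuck : ∀ v u, σ v = v → (faceGraph S).Adj u v → σ u ≠ u ∧ (faceGraph S).Adj (σ u) v) :
    SymRigid γ σ (faceGraph S) (verts S) := by
  have hσne : ∀ {x}, σ x ≠ x → σ (σ x) ≠ σ x := fun {x} hx => by rw [hσ x]; exact hx.symm
  have hmem : ∀ {U : Finset α} {a : α}, U ∈ S → a ∈ U → σ a ∈ U → σ a = a := by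
    intro U a hU ha hσa
    by_contra h
    exact hG a ⟨Ne.symm h, U, hU, ha, hσa⟩
  -- A member without a fixed vertex would force 2k + 2 moved vertices. By `hstuck` the fixed vertex
  -- is unique, so the other k vertices and their partners number 2k and exhaust the moved vertices.
  have hfacet : ∀ U ∈ S, ∃ v ∈ U, σ v = v ∧ (∀ u ∈ U, u ≠ v → σ u ≠ u) ∧
      ∀ x, σ x ≠ x → x ∈ U.erase v ∨ σ x ∈ U.erase v := by
    intro U hU
    have hpairs : ∀ A ⊆ U, (∀ a ∈ A, σ a ≠ a) →
        A ∪ A.image σ ⊆ (verts S).filter (fun x => σ x ≠ x) ∧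
          (A ∪ A.image σ).card = 2 * A.card := by
      intro A hA hmove
      constructor
      · intro x hx
        rw [Finset.mem_filter]
        rcases Finset.mem_union.1 hx with hx | hx
        · exact ⟨hsupp x (hmove x hx), hmove x hx⟩
        · obtain ⟨a, ha, rfl⟩ := Finset.mem_image.1 hx
          have := hσne (hmove a ha)
          exact ⟨hsupp _ this, this⟩
      · rw [Finset.card_union_of_disjoint, Finset.card_image_of_injective _ hσ.injective, two_mul]
        refine Finset.disjoint_left.2 fun x hx hx' => ?_
        obtain ⟨a, ha, rfl⟩ := Finset.mem_image.1 hx'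
        exact hmove a ha (hmem hU (hA ha) (hA hx))
    obtain ⟨v, hvU, hσv⟩ : ∃ v ∈ U, σ v = v := by
      by_contra! hcon
      obtain ⟨h1, h2⟩ := hpairs U subset_rfl hcon
      have := (Finset.card_le_card h1).trans hcard
      rw [h2, hS.1 U hU] at this
      omega
    have hmove : ∀ u ∈ U, u ≠ v → σ u ≠ u := fun u hu huv =>
      (hstuck v u hσv ⟨huv, U, hU, hu, hvU⟩).1
    refine ⟨v, hvU, hσv, hmove, fun x hx => ?_⟩
    obtain ⟨h1, h2⟩ := hpairs (U.erase v) (Finset.erase_subset _ _) fun a ha =>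
      hmove a (Finset.mem_of_mem_erase ha) (Finset.ne_of_mem_erase ha)
    have heq := Finset.eq_of_subset_of_card_le h1 (by
      rw [h2, Finset.card_erase_of_mem hvU, hS.1 U hU]; exact hcard)
    have hx' : x ∈ (verts S).filter (fun x => σ x ≠ x) := Finset.mem_filter.2 ⟨hsupp x hx, hx⟩
    rw [← heq] at hx'
    refine (Finset.mem_union.1 hx').imp_right fun h => ?_
    obtain ⟨a, ha, rfl⟩ := Finset.mem_image.1 h
    rwa [hσ a]
  -- The vertex z replacing y is adjacent to the fixed vertex, hence moved, so its partner is in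
  -- `U`. Partners are non-adjacent, so that partner must be the removed y.
  have hflip : ∀ U ∈ S, ∀ y ∈ U, σ y ≠ y → insert (σ y) (U.erase y) ∈ S := by
    intro U hU y hy hσy
    obtain ⟨v, hvU, hσv, -, hX⟩ := hfacet U hU
    obtain ⟨z, hz, hzS⟩ := hS.exists_swap hU hy
    have hvy : v ≠ y := by rintro rfl; exact hσy hσv
    have hzv : z ≠ v := by rintro rfl; exact hz hvU
    have hmz := (hstuck v z hσv ⟨hzv, _, hzS, Finset.mem_insert_self _ _,
      Finset.mem_insert_of_mem (Finset.mem_erase.2 ⟨hvy, hvU⟩)⟩).1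
    have hσz : σ z ∈ U := Finset.mem_of_mem_erase
      ((hX z hmz).resolve_left fun h => hz (Finset.mem_of_mem_erase h))
    have hzy : σ z = y := by
      by_contra hne
      exact hmz (hmem hzS (Finset.mem_insert_self _ _)
        (Finset.mem_insert_of_mem (Finset.mem_erase.2 ⟨hne, hσz⟩)))
    rwa [← hzy, hσ z, hzy]
  have hfree : ∀ w ∈ verts S, σ w = w → ∀ x, σ x ≠ x → (faceGraph S).Adj x w := by
    intro w hw hσw x hx
    obtain ⟨U, hU, hwU⟩ := mem_verts.1 hw
    obtain ⟨v, -, -, hmove, hX⟩ := hfacet U hU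
    have hwv : w = v := by
      by_contra h
      exact hmove w hwU h hσw
    subst hwv
    have hadj : ∀ y ∈ U.erase w, (faceGraph S).Adj y w := fun y hy =>
      ⟨Finset.ne_of_mem_erase hy, U, hU, Finset.mem_of_mem_erase hy, hwU⟩
    rcases hX x hx with h | h
    · exact hadj x h
    · have := (hstuck w (σ x) hσw (hadj _ h)).2
      rwa [hσ x] at this
  obtain ⟨U, hU⟩ := hSne
  obtain ⟨v, hvU, hσv, hmove, hX⟩ := hfacet U hU
  set Y := U.erase v with hY
  have hYcard : Y.card = k := by rw [hY, Finset.card_erase_of_mem hvU, hS.1 U hU]; simp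
  have hYmove : ∀ y ∈ Y, σ y ≠ y := fun y hy =>
    hmove y (Finset.mem_of_mem_erase hy) (Finset.ne_of_mem_erase hy)
  have hYσ : ∀ y ∈ Y, σ y ∉ Y := fun y hy h =>
    hYmove y hy (hmem hU (Finset.mem_of_mem_erase hy) (Finset.mem_of_mem_erase h))
  -- At most two flips of `U` give a member containing both: the moved vertices form a
  -- cross-polytope graph.
  have hadjX : ∀ a b, σ a ≠ a → σ b ≠ b → a ≠ b → b ≠ σ a → (faceGraph S).Adj a b := by
    intro a b ha hb hab hba
    have hYU : ∀ {y}, y ∈ Y → y ∈ U := fun h => Finset.mem_of_mem_erase h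
    have haσb : a ≠ σ b := fun h => hba (by rw [h, hσ b])
    have hflip' : ∀ c, σ c ≠ c → σ c ∈ Y → insert c (U.erase (σ c)) ∈ S := by
      intro c hc hcY
      have := hflip U hU (σ c) (hYU hcY) (hσne hc)
      rwa [hσ c] at this
    rcases hX a ha with haY | haY <;> rcases hX b hb with hbY | hbY
    · exact ⟨hab, U, hU, hYU haY, hYU hbY⟩
    · exact ⟨hab, _, hflip' b hb hbY, Finset.mem_insert_of_mem (Finset.mem_erase.2
        ⟨haσb, hYU haY⟩), Finset.mem_insert_self _ _⟩
    · exact ⟨hab, _, hflip' a ha haY, Finset.mem_insert_self _ _,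
        Finset.mem_insert_of_mem (Finset.mem_erase.2 ⟨hba, hYU hbY⟩)⟩
    · have h1 := hflip _ (hflip' b hb hbY) (σ a) (Finset.mem_insert_of_mem (Finset.mem_erase.2
        ⟨fun h => hab (hσ.injective h), hYU haY⟩)) (hσne ha)
      rw [hσ a] at h1
      exact ⟨hab, _, h1, Finset.mem_insert_self _ _, Finset.mem_insert_of_mem (Finset.mem_erase.2
        ⟨hba, Finset.mem_insert_self _ _⟩)⟩
  obtain ⟨v₂, hv₂U, hv₂S⟩ := hS.exists_swap hU hvU
  have hv₂Y : v₂ ∉ Y := fun h => hv₂U (Finset.mem_of_mem_erase h)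
  have hσv₂ : σ v₂ = v₂ := by
    by_contra h
    exact h (hmem hv₂S (Finset.mem_insert_self _ _)
      (Finset.mem_insert_of_mem ((hX v₂ h).resolve_left hv₂Y)))
  have hvv₂ : v ≠ v₂ := by rintro rfl; exact hv₂U hvU
  have hv₂V : v₂ ∈ verts S := subset_verts hv₂S (Finset.mem_insert_self _ _)
  have hvV : v ∈ verts S := subset_verts hU hvU
  obtain ⟨x, hx, x₂, hx₂, hxx₂⟩ := Finset.one_lt_card.1 (show 1 < Y.card by omega)
  -- The auxiliary edge lets σ x be attached to all k + 1 vertices of `U₀`. Splitting `v` off `x`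
  -- later hands this edge over to v and σ x, which are adjacent in the original graph.
  set H := faceGraph S ⊔ SimpleGraph.edge x (σ x) with hH
  set U₀ := insert v₂ Y with hU₀
  have hGH : ∀ {a b}, (faceGraph S).Adj a b → H.Adj a b := fun h => Or.inl h
  have hU₀card : U₀.card = k + 1 := hS.1 _ hv₂S
  have hU₀clique := isClique_faceGraph hv₂S
  have hYclique : (faceGraph S).IsClique (Y : Set α) :=
    hU₀clique.subset (by rw [hU₀]; exact_mod_cast Finset.subset_insert _ _)
  have : Nonempty α := ⟨v⟩
  have hU₀pair := atMostOnePair_of_isClique hU₀clique hG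
  have hσU₀ : ∀ y ∈ Y, σ y ∉ U₀ := by
    intro y hy h
    rcases Finset.mem_insert.1 h with h | h
    · have hyv : y = v₂ := by rw [← hσ y, h, hσv₂]
      exact hYmove y hy (h.trans hyv.symm)
    · exact hYσ y hy h
  have hrig₁ : SymRigid γ σ H (insert (σ x) U₀) := by
    refine (symRigid_clique hσ hγ hne hU₀card (fun a ha b hb hab => hGH (hU₀clique ha hb hab))
      hU₀pair).insert_vertex hσ hγ hne subset_rfl hU₀card (fun n hn => ?_)
        (AtMostOnePair.of_insert_isClique hU₀clique hG)
    rcases Finset.mem_insert.1 hn with rfl | hn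
    · exact hGH (hfree _ hv₂V hσv₂ _ (hσne (hYmove x hx))).symm
    · by_cases hnx : n = x
      · subst hnx
        exact Or.inr ((SimpleGraph.edge_adj ..).2 ⟨Or.inl ⟨rfl, rfl⟩, (hYmove n hx).symm⟩)
      · refine hGH (hadjX n (σ x) (hYmove n hn) (hσne (hYmove x hx)) ?_ ?_)
        · rintro rfl; exact hYσ x hx hn
        · exact fun h => hnx (hσ.injective h).symm
  -- Each σ y is attached to σ x and to `U₀` without y; the flipped member σ y + (`U₀` - y) is a
  -- clique, so only σ x can create a pair.
  have hrig₂ : ∀ Y' ⊆ Y.erase x, SymRigid γ σ H (insert (σ x) U₀ ∪ Y'.image σ) := by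
    intro Y' hY'
    induction Y' using Finset.induction_on with
    | empty => simpa using hrig₁
    | insert y Y' hy ih =>
      have hyY := hY' (Finset.mem_insert_self _ _)
      have hyx := Finset.ne_of_mem_erase hyY
      have hyY := Finset.mem_of_mem_erase hyY
      have hyU₀ : y ∈ U₀ := Finset.mem_insert_of_mem hyY
      rw [Finset.image_insert, Finset.union_insert]
      have hσxN : σ x ∉ U₀.erase y := fun h => hσU₀ x hx (Finset.mem_of_mem_erase h)
      refine (ih ((Finset.subset_insert _ _).trans hY')).insert_vertex hσ hγ hne
        (N := insert (σ x) (U₀.erase y)) ?_ ?_ (fun n hn => ?_) ?_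
      · exact (Finset.insert_subset_insert _ (Finset.erase_subset _ _)).trans
          Finset.subset_union_left
      · rw [Finset.card_insert_of_notMem hσxN, Finset.card_erase_of_mem hyU₀, hU₀card]
        simp
      · apply hGH
        rcases Finset.mem_insert.1 hn with rfl | hn
        · refine hadjX _ _ (hσne (hYmove x hx)) (hσne (hYmove y hyY)) ?_ ?_
          · exact fun h => hyx (hσ.injective h).symm
          · rw [hσ x]; exact fun h => hYσ y hyY (h ▸ hx)
        · obtain ⟨hny, hn⟩ := Finset.mem_erase.1 hn
          rcases Finset.mem_insert.1 hn with rfl | hn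
          · exact (hfree _ hv₂V hσv₂ _ (hσne (hYmove y hyY))).symm
          · refine hadjX _ _ (hYmove n hn) (hσne (hYmove y hyY)) ?_ ?_
            · rintro rfl; exact hYσ y hyY hn
            · exact fun h => hny (hσ.injective h).symm
      · rw [Finset.insert_comm]
        exact AtMostOnePair.of_insert_isClique (isClique_faceGraph (hflip U₀ hv₂S y hyU₀ (hYmove y hyY))) hG
  set W := insert (σ x) U₀ ∪ (Y.erase x).image σ with hW
  have hWmem : ∀ z ∈ W, z = v₂ ∨ σ z ≠ z := by
    intro z hz
    rcases Finset.mem_union.1 hz with hz | hz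
    · rcases Finset.mem_insert.1 hz with rfl | hz
      · exact Or.inr (hσne (hYmove x hx))
      · exact (Finset.mem_insert.1 hz).imp_right (hYmove z)
    · obtain ⟨y, hy, rfl⟩ := Finset.mem_image.1 hz
      exact Or.inr (hσne (hYmove y (Finset.mem_of_mem_erase hy)))
  have hWX : ∀ z, σ z ≠ z → z ∈ W := by
    intro z hz
    rcases hX z hz with h | h
    · exact Finset.mem_union_left _ (Finset.mem_insert_of_mem (Finset.mem_insert_of_mem h))
    · by_cases hzx : σ z = x
      · exact Finset.mem_union_left _ (Finset.mem_insert.2 (Or.inl (by rw [← hzx, hσ z])))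
      · exact Finset.mem_union_right _ (Finset.mem_image.2
          ⟨σ z, Finset.mem_erase.2 ⟨hzx, h⟩, hσ z⟩)
  have hU₀W : U₀ ⊆ W := (Finset.subset_insert _ _).trans Finset.subset_union_left
  have hsplit : SymRigid γ σ (faceGraph S) (insert v W) := by
    -- The k common neighbours of `x` and `v` are the other vertices of `Y` and σ x₂; a second
    -- element x₂ of `Y` exists since k ≥ 2.
    refine (hrig₂ _ subset_rfl).split hσ hγ hne (u := x) (C := insert (σ x₂) (Y.erase x))
      (fun h => ?_) hσv (hWX x (hYmove x hx)) (hfree v hvV hσv x (hYmove x hx)) ?_ ?_ ?_ ?_ ?_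
      hU₀W hU₀card hU₀clique hU₀pair
    · exact (hWmem v h).elim hvv₂ fun h => h hσv
    · rintro a - b - (hab | hab)
      · exact Or.inl hab
      · have hvσx := hfree v hvV hσv (σ x) (hσne (hYmove x hx))
        obtain ⟨⟨rfl, rfl⟩ | ⟨rfl, rfl⟩, -⟩ := (SimpleGraph.edge_adj ..).1 hab
        · exact Or.inr (Or.inl ⟨rfl, hvσx.symm⟩)
        · exact Or.inr (Or.inr ⟨rfl, hvσx⟩)
    · intro c hc
      rcases Finset.mem_insert.1 hc with rfl | hc
      · exact hWX _ (hσne (hYmove x₂ hx₂))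
      · exact hWX _ (hYmove c (Finset.mem_of_mem_erase hc))
    · intro c hc
      rcases Finset.mem_insert.1 hc with rfl | hc
      · have hm := hσne (hYmove x₂ hx₂)
        refine ⟨hadjX _ _ hm (hYmove x hx) ?_ ?_, hfree v hvV hσv _ hm⟩
        · exact fun h => hYσ x₂ hx₂ (h ▸ hx)
        · rw [hσ x₂]; exact hxx₂
      · obtain ⟨hcx, hcY⟩ := Finset.mem_erase.1 hc
        exact ⟨hYclique hcY hx hcx, hfree v hvV hσv _ (hYmove c hcY)⟩
    · rw [Finset.card_insert_of_notMem fun h => hYσ x₂ hx₂ (Finset.mem_of_mem_erase h),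
        Finset.card_erase_add_one hx, hYcard]
    · rw [Finset.insert_comm, Finset.insert_erase hx]
      exact AtMostOnePair.of_insert_isClique hYclique hG
  have hrest : ∀ R : Finset α, (∀ w ∈ R, w ∈ verts S ∧ σ w = w) →
      SymRigid γ σ (faceGraph S) (insert v W ∪ R) := by
    intro R hR
    induction R using Finset.induction_on with
    | empty => simpa using hsplit
    | insert w R hw ih =>
      obtain ⟨hwV, hσw⟩ := hR w (Finset.mem_insert_self _ _)
      rw [Finset.union_insert]
      have hmoveN : ∀ n ∈ insert (σ x) Y, σ n ≠ n := by
        intro n hn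
        rcases Finset.mem_insert.1 hn with rfl | hn
        exacts [hσne (hYmove x hx), hYmove n hn]
      refine (ih fun z hz => hR z (Finset.mem_insert_of_mem hz)).insert_vertex hσ hγ hne
        (N := insert (σ x) Y) (fun n hn => ?_) ?_ (fun n hn => ?_) ?_
      · exact Finset.mem_union_left _ (Finset.mem_insert_of_mem (hWX n (hmoveN n hn)))
      · rw [Finset.card_insert_of_notMem (hYσ x hx), hYcard]
      · exact hfree w hwV hσw n (hmoveN n hn)
      · rw [Finset.insert_comm]
        refine AtMostOnePair.of_insert_isClique (G := faceGraph S) ?_ hG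
        rw [Finset.coe_insert]
        exact hYclique.insert fun b hb _ => (hfree w hwV hσw b (hYmove b hb)).symm
  have hfinal := hrest ((verts S).filter fun w => σ w = w) (by simp)
  convert hfinal using 1
  ext z
  simp only [Finset.mem_union, Finset.mem_insert, Finset.mem_filter]
  constructor
  · intro hz
    by_cases hσz : σ z = z
    exacts [Or.inr ⟨hz, hσz⟩, Or.inl (Or.inr (hWX z hσz))]
  · rintro ((rfl | hz) | hz)
    · exact hvV
    · rcases hWmem z hz with rfl | h
      exacts [hv₂V, hsupp z h]
    · exact hz.1

/-- Graphs of simplicial circuits are rigid in some symmetric configuration. -/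
theorem symRigid_of_isSimplicialCircuit (hk : 2 ≤ k) (hγ : ∀ x, γ *ᵥ (γ *ᵥ x) = x)
    (hne : ∃ a, γ *ᵥ a ≠ a) (n : ℕ) (S : Multiset (Finset α)) (hS : IsSimplicialCircuit k S)
    (hn : (verts S.toFinset).card ≤ n) (σ : α → α) (hσ : Function.Involutive σ)
    (hG : ∀ x, ¬ (faceGraph S.toFinset).Adj x (σ x))
    (hcard : ((verts S.toFinset).filter fun x => σ x ≠ x ∧ σ x ∈ verts S.toFinset).card ≤ 2 * k) :
    SymRigid γ σ (faceGraph S.toFinset) (verts S.toFinset) := by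
  induction n generalizing S σ with
  | zero =>
    obtain ⟨U, hU⟩ := Multiset.exists_mem_of_ne_zero hS.1
    have hUcard := hS.2.1.1 U hU
    have := Finset.card_le_card (subset_verts (Multiset.mem_toFinset.2 hU))
    omega
  | succ n ih =>
    rcases hS.cases with ⟨T, rfl, hT⟩ | ⟨U, hU, rfl⟩
    · rw [Finset.val_toFinset] at *
      -- A vertex whose partner is absent from this circuit becomes fixed, and so available for
      -- contraction.
      refine SymRigid.of_restrictInvolution hσ hγ ?_
      set τ := restrictInvolution σ (verts T) with hτ
      have hτinv : Function.Involutive τ := restrictInvolution_involutive hσ _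
      have hτmove : ∀ x, τ x ≠ x → x ∈ verts T ∧ σ x ∈ verts T ∧ τ x = σ x := by
        intro x hx
        by_cases h : x ∈ verts T ∧ σ x ∈ verts T
        · exact ⟨h.1, h.2, if_pos h⟩
        · exact absurd (if_neg h) hx
      have hGτ : ∀ x, ¬ (faceGraph T).Adj x (τ x) := by
        intro x hx
        have := (hτmove x hx.ne').2.2
        exact hG x (this ▸ hx)
      have hsub : (verts T).filter (fun x => τ x ≠ x) ⊆
          (verts T).filter fun x => σ x ≠ x ∧ σ x ∈ verts T := by
        intro x hx
        obtain ⟨hxT, hxm⟩ := Finset.mem_filter.1 hx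
        obtain ⟨-, h2, h3⟩ := hτmove x hxm
        exact Finset.mem_filter.2 ⟨hxT, h3 ▸ hxm, h2⟩
      have hcardτ := (Finset.card_le_card hsub).trans hcard
      by_cases hstuck : ∀ v u, τ v = v → (faceGraph T).Adj u v →
          τ u ≠ u ∧ (faceGraph T).Adj (τ u) v
      · exact symRigid_of_no_contraction hk hτinv hγ hne hT.2.1 hT.1 hGτ
          (fun x hx => (hτmove x hx).1) hcardτ hstuck
      · push Not at hstuck
        obtain ⟨v, u, hτv, huv, hnot⟩ := hstuck
        have huv' := huv.1
        obtain ⟨U₀, hU₀, huU₀, hvU₀⟩ := huv.2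
        refine symRigid_of_forall_contraction hk hτinv hγ hne hT huv hτv hGτ fun R hR hRcirc => ?_
        have hRT : R ⊆ T := hR.trans (Finset.filter_subset _ _)
        have hRV : verts R ⊆ verts T := Finset.biUnion_subset_biUnion_of_subset_left _ hRT
        have hVsub : verts (R.image (contractSet u v)) ⊆ (verts T).erase v := by
          intro x hx
          rw [Finset.mem_erase]
          rcases (mem_verts_image huv').1 hx with ⟨h1, h2⟩ | ⟨rfl, -⟩
          exacts [⟨h1, hRV h2⟩, ⟨huv', subset_verts hU₀ huU₀⟩]
        refine ih _ hRcirc ?_ τ hτinv (fun x hx => ?_) ?_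
        · have h1 := Finset.card_le_card hVsub
          rw [Finset.card_erase_of_mem (subset_verts hU₀ hvU₀)] at h1
          change (verts (R.image (contractSet u v))).card ≤ n
          omega
        -- A pair made adjacent by the contraction would be u and τ u with τ u adjacent to v, which
        -- the choice of uv excludes.
        · rcases faceGraph_image_adj huv' hx with h | ⟨rfl, h⟩ | ⟨h1, h⟩
          · exact hGτ x (faceGraph_mono hRT h)
          · exact hnot hx.ne' (faceGraph_mono hRT h).symm
          · have hxu : τ u = x := by rw [← h1, hτinv x]
            refine hnot (by rw [hxu, ← h1]; exact hx.ne) ?_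
            rw [hxu]
            exact faceGraph_mono hRT h
        · refine (Finset.card_le_card fun x hx => ?_).trans hcardτ
          obtain ⟨h1, h2, -⟩ := Finset.mem_filter.1 hx
          exact Finset.mem_filter.2 ⟨Finset.mem_of_mem_erase (hVsub h1), h2⟩
    · have hmem : U ∈ ({U, U} : Multiset (Finset α)).toFinset := by simp
      have hV : verts ({U, U} : Multiset (Finset α)).toFinset = U := by simp [verts]
      obtain ⟨x, -⟩ : U.Nonempty := Finset.card_pos.1 (by omega)
      have : Nonempty α := ⟨x⟩
      have hclique := isClique_faceGraph hmem
      rw [hV]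
      exact symRigid_clique hσ hγ hne hU hclique (atMostOnePair_of_isClique hclique hG)

lemma coe_verts_toFinset (S : Multiset (Finset α)) :
    (verts S.toFinset : Set α) = vertexSet S := by
  ext x
  simp [mem_verts, vertexSet]

lemma RigidOn.isInfinitesimallyRigid {d : ℕ} {S : Multiset (Finset α)} {p : α → Fin d → ℝ}
    (h : RigidOn (faceGraph S.toFinset) (verts S.toFinset) p) :
    IsInfinitesimallyRigid (graph S) fun i : vertexSet S => p i := by
  classical
  intro q hq
  have hV : ∀ {x}, x ∈ verts S.toFinset ↔ x ∈ vertexSet S := fun {x} => by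
    rw [← coe_verts_toFinset, Finset.mem_coe]
  let q' : α → Fin d → ℝ := fun x => if hx : x ∈ vertexSet S then q ⟨x, hx⟩ else 0
  have hq' : ∀ x : vertexSet S, q' x = q x := fun x => by simp [q']
  obtain ⟨A, t, hA, ht⟩ := h.2 q' fun i hi j hj hij => by
    have := hq ⟨i, hV.1 hi⟩ ⟨j, hV.1 hj⟩ ⟨fun h => hij.1 (congrArg Subtype.val h), by
      obtain ⟨U, hU, h⟩ := hij.2
      exact ⟨U, Multiset.mem_toFinset.1 hU, h⟩⟩
    rw [← hq', ← hq'] at this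
    exact this
  exact ⟨A, t, hA, fun i => by rw [← hq', ht i (hV.2 i.2)]⟩

theorem isGammaRigid_graph (hk : 2 ≤ k) {S : Multiset (Finset α)} (hS : IsSimplicialCircuit k S)
    (P : VertexPairing (vertexSet S)) (hP : P.IsNonAdjacent (graph S)) (hcard : P.X.card ≤ 2 * k)
    (Γ : Subgroup (Matrix.orthogonalGroup (Fin (k + 1)) ℝ)) (hΓ : Nat.card Γ = 2) :
    IsGammaRigid Γ (graph S) P := by
  obtain ⟨g, hg, hgu⟩ := (Nat.card_eq_two_iff' (1 : Γ)).1 hΓ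
  set γ : Matrix (Fin (k + 1)) (Fin (k + 1)) ℝ := ((g : Matrix.orthogonalGroup (Fin (k + 1)) ℝ) :
    Matrix (Fin (k + 1)) (Fin (k + 1)) ℝ) with hγdef
  have hgg : g * g = 1 := by
    have := pow_card_eq_one' (x := g)
    rwa [hΓ, pow_two] at this
  have hγγ : γ * γ = 1 := by
    have := congrArg (fun h : Γ => ((h : Matrix.orthogonalGroup (Fin (k + 1)) ℝ) :
      Matrix (Fin (k + 1)) (Fin (k + 1)) ℝ)) hgg
    simpa using this
  have hγ1 : γ ≠ 1 := by
    intro h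
    exact hg (Subtype.ext (Subtype.ext h))
  have hne : ∃ a, γ *ᵥ a ≠ a := by
    by_contra! h
    exact hγ1 (Matrix.mulVec_injective (funext fun a => by rw [h, Matrix.one_mulVec]))
  have hadj : ∀ x, ¬ (faceGraph S.toFinset).Adj x (P.involution x) := by
    intro x hx
    obtain ⟨y, rfl⟩ := P.exists_of_involution_ne hx.ne'
    rw [P.involution_coe] at hx
    refine hP y ⟨fun h => hx.1 (congrArg Subtype.val h), ?_⟩
    obtain ⟨U, hU, h⟩ := hx.2
    exact ⟨U, Multiset.mem_toFinset.1 hU, h⟩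
  obtain ⟨p, hp, hr⟩ := symRigid_of_isSimplicialCircuit hk
    (fun x => by rw [Matrix.mulVec_mulVec, hγγ, Matrix.one_mulVec]) hne _ S hS le_rfl P.involution
    P.involution_involutive hadj (by
      refine (Finset.card_le_card (t := P.X.image Subtype.val) fun x hx => ?_).trans
        (Finset.card_image_le.trans hcard)
      obtain ⟨y, rfl⟩ := P.exists_of_involution_ne (Finset.mem_filter.1 hx).2.1
      exact Finset.mem_image_of_mem _ y.2)
  refine ⟨fun i => p i, fun g' hg' hg'1 x => ?_, hr.isInfinitesimallyRigid⟩
  have hgg' : (⟨g', hg'⟩ : Γ) = g := hgu _ fun h => hg'1 (congrArg Subtype.val h)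
  have hg'γ : (g' : Matrix (Fin (k + 1)) (Fin (k + 1)) ℝ) = γ := by rw [hγdef, ← hgg']
  rw [hg'γ]
  have hx : P.involution ((x : vertexSet S) : α) ≠ (x : vertexSet S) := by
    rw [P.involution_coe]
    exact fun h => P.star_ne x (Subtype.ext (Subtype.ext h))
  have := hp _ hx
  rwa [P.involution_coe] at this

/-- For σ = id the symmetry condition is empty, and γ = -1 serves as an arbitrary non-identity
involution. -/
theorem isRigid_graph (hk : 2 ≤ k) {S : Multiset (Finset α)} (hS : IsSimplicialCircuit k S) :
    IsRigid (k + 1) (graph S) := by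
  obtain ⟨p, -, hr⟩ := symRigid_of_isSimplicialCircuit (k := k) (γ := -1) hk
    (fun x => by simp [Matrix.neg_mulVec]) ⟨1, fun h => by
      have := congrFun h 0
      norm_num [Matrix.neg_mulVec] at this⟩ _ S hS le_rfl id (fun _ => rfl)
    (fun x h => h.1 rfl) (by simp)
  exact ⟨_, hr.isInfinitesimallyRigid⟩

end Main

end CircuitRigidity

theorem mainTheorem6 {α : Type*} (k : ℕ) (hk : 2 ≤ k) (S : Multiset (Finset α))
    (hS : CircuitRigidity.IsSimplicialCircuit k S) :
    (∀ P : CircuitRigidity.VertexPairing (CircuitRigidity.vertexSet S),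
      P.IsNonAdjacent (CircuitRigidity.graph S) → P.X.card ≤ 2 * k →
        ∀ Γ : Subgroup (Matrix.orthogonalGroup (Fin (k + 1)) ℝ), Nat.card Γ = 2 →
          CircuitRigidity.IsGammaRigid Γ (CircuitRigidity.graph S) P) ∧
    CircuitRigidity.IsRigid (k + 1) (CircuitRigidity.graph S) := by
  classical
  exact ⟨fun P hP hcard Γ hΓ => CircuitRigidity.isGammaRigid_graph hk hS P hP hcard Γ hΓ,
    CircuitRigidity.isRigid_graph hk hS⟩
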